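/- Let $\mathbb T^2=\mathbb R^2/\mathbb Z^2$ and let $u_0\in C^1(\mathbb T^2;\mathbb R^2)$ be such that, for some $\alpha_0>0$, $|u_0(x)|+|\det\nabla u_0(x)|\ge\alpha_0$ for all $x\in\mathbb T^2$. For $\varepsilon>0$ let $u$ denote the solution of the Ginzburg–Landau heat flow $$\partial_t u-\varepsilon^2\Delta u=(1-|u|^2)u\quad (t>0,\ x\in\mathbb T^2),\qquad u(0,\cdot)=u_0,$$ that is, the classical solution: continuous on $[0,\infty)\times\mathbb T^2$, of class $C^1$ in $t$ and $C^2$ in $x$ on $(0,\infty)\times\mathbb T^2$. Let $$E_\varepsilon(u)=\int_{\mathbb T^2}|\nabla u|^2+\frac1{4\varepsilon^2}(1-|u|^2)^2\,dx .$$ Fix a constant $C_0>0$ and set $T_\varepsilon=\ln\frac1\varepsilon-\frac12\ln\ln\frac1\varepsilon-C_0$. Then there exist constants $C>0$ and $\varepsilon_0>0$, depending only on $u_0$ and $C_0$, such that for all $\varepsilon\in(0,\varepsilon_0)$ $$E_\varepsilon(u(t))\le C\ln\frac1\varepsilon\qquad\text{for all } t\ge T_\varepsilon .$$ -/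

import Mathlib

open scoped Laplacian

noncomputable section

namespace GinzburgLandau

/-- The Euclidean plane `ℝ²`. -/
abbrev Plane : Type := EuclideanSpace ℝ (Fin 2)

/-- The flat torus `𝕋² = ℝ²/ℤ²`. -/
abbrev Torus : Type := UnitAddTorus (Fin 2)

/-- The `ℤ²`-periodic map on `ℝ²` that a map on `𝕋²` defines by composition with the projection
`ℝ² → ℝ²/ℤ²`. Since the projection is a local isometry, derivatives on the flat torus are the
derivatives of this map. -/
def lift (f : Torus → Plane) (x : Plane) : Plane := f (fun i => ((x i : ℝ) : UnitAddCircle))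

/-- The unit cell `[0,1)²`, a fundamental domain of the torus. -/
def unitCell : Set Plane := {x | ∀ i, x i ∈ Set.Ico (0 : ℝ) 1}

/-- `|∇F(x)|²`, the sum of the squares of all first partial derivatives. -/
def gradSq (F : Plane → Plane) (x : Plane) : ℝ :=
  ∑ i : Fin 2, ‖fderiv ℝ F x (EuclideanSpace.single i 1)‖ ^ 2

/-- The Ginzburg–Landau energy `E_ε(f) = ∫_{𝕋²} |∇f|² + (1 - |f|²)² / (4 ε²)`. -/
def energy (ε : ℝ) (f : Torus → Plane) : ℝ :=
  ∫ x in unitCell, (gradSq (lift f) x + 1 / (4 * ε ^ 2) * (1 - ‖lift f x‖ ^ 2) ^ 2)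

/-- `u` is a (global, classical) solution of the Ginzburg–Landau heat flow
`∂ₜu - ε² Δu = (1 - |u|²) u` on the torus with initial value `u₀`: it is continuous on
`[0,∞) × 𝕋²`, of class `C¹` in time and `C²` in space on `(0,∞) × 𝕋²`, satisfies the equation
there, and equals `u₀` at time `0`. (Values at negative times play no role.) -/
structure IsSolution (ε : ℝ) (u₀ : Torus → Plane) (u : ℝ → Torus → Plane) : Prop where
  initial : u 0 = u₀
  continuousOn : ContinuousOn (fun p : ℝ × Torus => u p.1 p.2) (Set.Ici 0 ×ˢ Set.univ)
  differentiableAt_time : ∀ t, 0 < t → ∀ x : Plane,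
    DifferentiableAt ℝ (fun s => lift (u s) x) t
  continuousOn_deriv_time : ContinuousOn
    (fun p : ℝ × Plane => deriv (fun s => lift (u s) p.2) p.1) (Set.Ioi 0 ×ˢ Set.univ)
  contDiff_space : ∀ t, 0 < t → ContDiff ℝ 2 (lift (u t))
  continuousOn_fderiv : ContinuousOn
    (fun p : ℝ × Plane => fderiv ℝ (lift (u p.1)) p.2) (Set.Ioi 0 ×ˢ Set.univ)
  continuousOn_fderiv_fderiv : ContinuousOn
    (fun p : ℝ × Plane => fderiv ℝ (fderiv ℝ (lift (u p.1))) p.2) (Set.Ioi 0 ×ˢ Set.univ)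
  equation : ∀ t, 0 < t → ∀ x : Plane,
    deriv (fun s => lift (u s) x) t - ε ^ 2 • (Δ (lift (u t))) x
      = (1 - ‖lift (u t) x‖ ^ 2) • lift (u t) x

/-- The time `T_ε = ln (1/ε) - ½ ln ln (1/ε) - C₀`. -/
def entryTime (C₀ ε : ℝ) : ℝ :=
  Real.log (1 / ε) - 1 / 2 * Real.log (Real.log (1 / ε)) - C₀

end GinzburgLandau

end

/-! Without diffusion, `m = |u|²` solves `m' = 2(1 - m)m`. With `E = e^{2t}` and the defect `N = E -
(E - 1)m`, this gives `m = m₀N` and `N = E/(1 + (E - 1)m₀)`: by time `t` the modulus is close to 1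
except within distance about `e^{-t}` of the zeros of `u₀`. The proof shows that diffusion does not
spoil this picture as long as `ε²E` and `ε²Et` are at most 1.

Two maximum principles carry the argument. First, `|∂ᵢu|² ≤ K N` (`norm_pd_sq_le`): without
diffusion `N` solves `N' = 2(1 - m)N`, the reaction term makes `|∂ᵢu|²` grow no faster than this,
and diffusion acts on the two quantities with favourable signs. Secondly, `m ≥ qN` (`barrier_le`),
where `q` is a smooth minorant `d` of `|u₀|²`, slightly decreased to pay for the diffusion errors;
these are controlled by the first bound. Since `E = N + (E - 1)m`, the barrier yields `N(1 + σd) ≤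
const · E` with `σ` comparable to `E` (`defect_mul_le`).

Nondegeneracy makes `|u₀|` at least linear in the distance to its zeros, so `d` can be built with at
least quadratic growth away from a finite set of points (`exists_smooth_minorant`). Integrating
`1/(1 + σr²)` in two dimensions gives `log σ / σ`, and its square gives `1/σ`. Hence the gradient
energy is `O(t)`, and, because `1 - m = (N - 1)/(E - 1)`, the potential energy is `O(1/(ε²E))`
(`exists_energy_bound`). The entry time is chosen so that `1/(ε²E)` equals `e^{2C₀} ln(1/ε)`, and
there `t` is at most `ln(1/ε)`.

Later times follow from dissipation (`antitoneOn_freeEnergy`). The functional that decreases carries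
`|∇u|²/2` instead of `|∇u|²`, and differs from the energy by at most a factor 2. -/

open scoped Laplacian

noncomputable section

namespace GinzburgLandau

/-! ### Partial derivatives on the plane -/

section PartialDerivatives

variable {V : Type*} [NormedAddCommGroup V] [NormedSpace ℝ V]

/-- The `i`-th partial derivative. -/
def pd (i : Fin 2) (F : Plane → V) (x : Plane) : V :=
  fderiv ℝ F x (EuclideanSpace.single i 1)

theorem contDiff_pd {F : Plane → V} (hF : ContDiff ℝ 2 F) (i : Fin 2) :
    ContDiff ℝ 1 (pd i F) :=
  (hF.fderiv_right (m := 1) (by norm_num)).clm_apply contDiff_const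

theorem differentiable_of_contDiff_two {F : Plane → V} (hF : ContDiff ℝ 2 F) :
    Differentiable ℝ F := hF.differentiable (by norm_num)

theorem differentiable_pd {F : Plane → V} (hF : ContDiff ℝ 2 F) (i : Fin 2) :
    Differentiable ℝ (pd i F) := (contDiff_pd hF i).differentiable (by norm_num)

theorem continuous_pd {F : Plane → V} (hF : ContDiff ℝ 1 F) (i : Fin 2) :
    Continuous (pd i F) :=
  (hF.continuous_fderiv (by norm_num)).clm_apply continuous_const

theorem continuous_pd_pd {F : Plane → V} (hF : ContDiff ℝ 2 F) (i : Fin 2) :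
    Continuous (pd i (pd i F)) := continuous_pd (contDiff_pd hF i) i

theorem pd_pd_eq {F : Plane → V} (hF : ContDiff ℝ 2 F) (i : Fin 2) (x : Plane) :
    pd i (pd i F) x = fderiv ℝ (fderiv ℝ F) x (EuclideanSpace.single i 1)
      (EuclideanSpace.single i 1) := by
  have h : DifferentiableAt ℝ (fderiv ℝ F) x :=
    (hF.fderiv_right (m := 1) (by norm_num)).differentiable (by norm_num) x
  unfold pd
  rw [fderiv_clm_apply h (by fun_prop)]
  simp

theorem laplacian_eq_sum_pd {F : Plane → V} (hF : ContDiff ℝ 2 F) (x : Plane) :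
    (Δ F) x = ∑ i, pd i (pd i F) x := by
  rw [InnerProductSpace.laplacian_eq_iteratedFDeriv_orthonormalBasis F
    (EuclideanSpace.basisFun (Fin 2) ℝ)]
  simp only [iteratedFDeriv_two_apply]
  refine Finset.sum_congr rfl fun i _ => ?_
  rw [pd_pd_eq hF]
  simp

theorem gradSq_eq (F : Plane → Plane) (x : Plane) : gradSq F x = ∑ i, ‖pd i F x‖ ^ 2 := rfl

theorem pd_mul {f g : Plane → ℝ} (hf : Differentiable ℝ f) (hg : Differentiable ℝ g) (i : Fin 2) :
    pd i (fun x => f x * g x) = fun x => pd i f x * g x + f x * pd i g x := by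
  ext x
  unfold pd
  rw [fderiv_fun_mul (hf x) (hg x)]
  simp; ring

theorem pd_add {f g : Plane → V} (hf : Differentiable ℝ f) (hg : Differentiable ℝ g) (i : Fin 2) :
    pd i (fun x => f x + g x) = fun x => pd i f x + pd i g x := by
  ext x
  unfold pd
  rw [fderiv_fun_add (hf x) (hg x)]
  simp

theorem pd_sub {f g : Plane → V} (hf : Differentiable ℝ f) (hg : Differentiable ℝ g) (i : Fin 2) :
    pd i (fun x => f x - g x) = fun x => pd i f x - pd i g x := by
  ext x
  unfold pd
  rw [fderiv_fun_sub (hf x) (hg x)]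
  simp

theorem pd_const (c : V) (i : Fin 2) : pd i (fun _ => c) = fun _ => 0 := by
  ext x; simp [pd]

theorem pd_const_mul {f : Plane → ℝ} (hf : Differentiable ℝ f) (c : ℝ) (i : Fin 2) :
    pd i (fun x => c * f x) = fun x => c * pd i f x := by
  rw [pd_mul (by fun_prop) hf, pd_const]; simp

theorem pd_add_const (f : Plane → V) (c : V) (i : Fin 2) :
    pd i (fun x => f x + c) = pd i f := by
  ext x; simp [pd]

theorem pd_comp_add (F : Plane → V) (h : Plane) (i : Fin 2) :
    pd i (fun x => F (x + h)) = fun x => pd i F (x + h) := by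
  ext x; simp [pd, fderiv_comp_add_right]

theorem pd_pd_mul {f g : Plane → ℝ} (hf : ContDiff ℝ 2 f) (hg : ContDiff ℝ 2 g) (i : Fin 2)
    (x : Plane) :
    pd i (pd i (fun x => f x * g x)) x
      = pd i (pd i f) x * g x + 2 * (pd i f x * pd i g x) + f x * pd i (pd i g) x := by
  have df := differentiable_of_contDiff_two hf
  have dg := differentiable_of_contDiff_two hg
  have df' := differentiable_pd hf i
  have dg' := differentiable_pd hg i
  rw [pd_mul df dg, pd_add (f := fun x => pd i f x * g x) (g := fun x => f x * pd i g x)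
    (df'.mul dg) (df.mul dg'), pd_mul df' dg, pd_mul df dg']
  ring

theorem pd_norm_sq {F : Plane → Plane} (hF : Differentiable ℝ F) (i : Fin 2) :
    pd i (fun x => ‖F x‖ ^ 2) = fun x => 2 * inner ℝ (F x) (pd i F x) := by
  ext x
  unfold pd
  rw [((hF x).hasFDerivAt.norm_sq).fderiv]
  simp

theorem pd_inner {F G : Plane → Plane} (hF : Differentiable ℝ F) (hG : Differentiable ℝ G)
    (i : Fin 2) :
    pd i (fun x => inner ℝ (F x) (G x))
      = fun x => inner ℝ (pd i F x) (G x) + inner ℝ (F x) (pd i G x) := by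
  ext x
  unfold pd
  rw [fderiv_inner_apply ℝ (hF x) (hG x)]
  ring

theorem pd_pd_norm_sq {F : Plane → Plane} (hF : ContDiff ℝ 2 F) (i : Fin 2) (x : Plane) :
    pd i (pd i (fun x => ‖F x‖ ^ 2)) x
      = 2 * inner ℝ (F x) (pd i (pd i F) x) + 2 * ‖pd i F x‖ ^ 2 := by
  have d := differentiable_of_contDiff_two hF
  have d' := differentiable_pd hF i
  rw [pd_norm_sq d, pd_const_mul (d.inner ℝ d'), pd_inner d d']
  simp only [real_inner_self_eq_norm_sq]
  ring

/-- `Δ|F|² = 2 F · ΔF + 2 |∇F|²`. -/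
theorem sum_pd_pd_norm_sq {F : Plane → Plane} (hF : ContDiff ℝ 2 F) (x : Plane) :
    ∑ i, pd i (pd i (fun x => ‖F x‖ ^ 2)) x = 2 * inner ℝ (F x) ((Δ F) x) + 2 * gradSq F x := by
  simp only [pd_pd_norm_sq hF, gradSq_eq, laplacian_eq_sum_pd hF, Finset.sum_add_distrib,
    inner_sum, Finset.mul_sum]

theorem hasDerivAt_line {F : Plane → V} (hF : Differentiable ℝ F) (x : Plane) (i : Fin 2) (r : ℝ) :
    HasDerivAt (fun r : ℝ => F (x + r • EuclideanSpace.single i (1 : ℝ)))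
      (pd i F (x + r • EuclideanSpace.single i (1 : ℝ))) r := by
  have h1 : HasDerivAt (fun r : ℝ => x + r • EuclideanSpace.single i (1 : ℝ))
      (EuclideanSpace.single i (1 : ℝ)) r := by
    simpa using ((hasDerivAt_id r).smul_const (EuclideanSpace.single i (1 : ℝ))).const_add x
  exact (hF _).hasFDerivAt.comp_hasDerivAt r h1

/-- A negative second derivative would make the point a local maximum as well, so `f` would be
locally constant and its second derivative zero. -/
theorem deriv_deriv_nonneg_of_isLocalMin {f : ℝ → ℝ} {a : ℝ} (hf : ContinuousAt f a)
    (h : IsLocalMin f a) : 0 ≤ deriv (deriv f) a := by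
  by_contra! hneg
  have hmax := isLocalMax_of_deriv_deriv_neg hneg h.deriv_eq_zero hf
  have hconst : f =ᶠ[nhds a] fun _ => f a := by
    filter_upwards [h, hmax] with y h1 h2 using le_antisymm h2 h1
  have h2 := hconst.deriv.deriv_eq
  simp at h2
  exact hneg.ne h2

theorem pd_pd_nonneg_of_isLocalMin {f : Plane → ℝ} {x : Plane} (hf : ContDiff ℝ 2 f)
    (h : IsLocalMin f x) (i : Fin 2) : 0 ≤ pd i (pd i f) x := by
  set φ : ℝ → ℝ := fun r => f (x + r • EuclideanSpace.single i (1 : ℝ))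
  have d1 : deriv φ = fun r => pd i f (x + r • EuclideanSpace.single i (1 : ℝ)) :=
    funext fun r => (hasDerivAt_line (differentiable_of_contDiff_two hf) x i r).deriv
  have d2 : deriv (deriv φ) 0 = pd i (pd i f) x := by
    rw [d1, (hasDerivAt_line (differentiable_pd hf i) x i 0).deriv]; simp
  rw [← d2]
  have hc : Continuous (fun r : ℝ => x + r • EuclideanSpace.single i (1 : ℝ)) := by fun_prop
  refine deriv_deriv_nonneg_of_isLocalMin (hf.continuous.comp hc).continuousAt ?_
  have := hc.continuousAt (x := 0)
  refine IsLocalMin.comp_continuous (g := fun r : ℝ => x + r • EuclideanSpace.single i (1 : ℝ))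
    (b := 0) (by simpa using h) hc.continuousAt

end PartialDerivatives

/-! ### Periodic functions -/

/-- `ℤ²`-periodicity. -/
def IsPeriodic {α : Type*} (F : Plane → α) : Prop :=
  ∀ ⦃x y : Plane⦄, (∀ i, ∃ n : ℤ, y i = x i + n) → F y = F x

theorem isPeriodic_lift (f : Torus → Plane) : IsPeriodic (lift f) := by
  intro x y h
  unfold lift
  congr 1
  ext i
  obtain ⟨n, hn⟩ := h i
  rw [hn]
  simp

/-- The closed unit square. -/
def closedCell : Set Plane := {x | ∀ i, x i ∈ Set.Icc (0 : ℝ) 1}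

theorem isCompact_closedCell : IsCompact closedCell := by
  have : closedCell = (EuclideanSpace.equiv (Fin 2) ℝ).toHomeomorph ⁻¹'
      (Set.univ.pi fun _ => Set.Icc (0 : ℝ) 1) := by
    ext x; simp only [closedCell, Set.mem_pi, Set.mem_preimage, Set.mem_ofPred_eq,
      Set.mem_univ, true_implies]; rfl
  rw [this, Homeomorph.isCompact_preimage]
  exact isCompact_univ_pi fun _ => isCompact_Icc

/-- The representative in `[0,1)²`. -/
def fractPart (x : Plane) : Plane := WithLp.toLp 2 fun i => Int.fract (x i)

theorem fractPart_mem_unitCell (x : Plane) : fractPart x ∈ unitCell := fun _ =>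
  ⟨Int.fract_nonneg _, Int.fract_lt_one _⟩

theorem unitCell_subset_closedCell : unitCell ⊆ closedCell := fun _ hx i =>
  ⟨(hx i).1, (hx i).2.le⟩

theorem fractPart_mem_closedCell (x : Plane) : fractPart x ∈ closedCell :=
  unitCell_subset_closedCell (fractPart_mem_unitCell x)

theorem IsPeriodic.fractPart_eq {α : Type*} {F : Plane → α} (hF : IsPeriodic F) (x : Plane) :
    F (fractPart x) = F x :=
  (hF fun i => ⟨⌊x i⌋, (Int.fract_add_floor (x i)).symm⟩)|>.symm

theorem IsPeriodic.exists_bound {F : Plane → ℝ} (hF : IsPeriodic F) (hc : Continuous F) :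
    ∃ C, 0 < C ∧ ∀ x, |F x| ≤ C := by
  obtain ⟨C, hC⟩ := isCompact_closedCell.exists_bound_of_continuousOn hc.continuousOn
  refine ⟨|C| + 1, by positivity, fun x => ?_⟩
  rw [← hF.fractPart_eq]
  have := hC _ (fractPart_mem_closedCell x)
  rw [Real.norm_eq_abs] at this
  linarith [le_abs_self C]

theorem IsPeriodic.comp_add {α : Type*} {F : Plane → α} (hF : IsPeriodic F) (h : Plane) :
    IsPeriodic fun x => F (x + h) := by
  intro x y hxy
  refine hF fun i => ?_
  obtain ⟨n, hn⟩ := hxy i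
  exact ⟨n, by simp [hn]; ring⟩

theorem IsPeriodic.fderiv {V : Type*} [NormedAddCommGroup V] [NormedSpace ℝ V]
    {F : Plane → V} (hF : IsPeriodic F) : IsPeriodic (fderiv ℝ F) := by
  intro x y hxy
  have h : (fun z => F (z + (y - x))) = F := funext fun z => hF fun i => by
    obtain ⟨n, hn⟩ := hxy i
    exact ⟨n, by simp [hn]⟩
  conv_rhs => rw [← h]
  rw [fderiv_comp_add_right]
  simp

theorem IsPeriodic.pd {V : Type*} [NormedAddCommGroup V] [NormedSpace ℝ V]
    {F : Plane → V} (hF : IsPeriodic F) (i : Fin 2) : IsPeriodic (pd i F) := by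
  intro x y hxy
  unfold GinzburgLandau.pd
  rw [hF.fderiv hxy]

/-! ### The parabolic maximum principle on the torus -/

/-- Minimise `e^{-Λt} H` over `[0,T]` times a cell. At a negative minimum, which cannot lie at time
0, the strict inequality makes the time derivative positive, so slightly earlier values are smaller
still. The differential inequality is therefore needed only at negative spatial local minima, where
the applications use `ΔH ≥ 0` and the sign of `H`. -/
theorem nonneg_of_strict_supersolution {T Λ : ℝ} {H : ℝ → Plane → ℝ}
    (hper : ∀ t, IsPeriodic (H t))
    (hcont : ContinuousOn (fun p : ℝ × Plane => H p.1 p.2) (Set.Icc 0 T ×ˢ Set.univ))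
    (hinit : ∀ x, 0 ≤ H 0 x)
    (hstep : ∀ t ∈ Set.Ioc 0 T, ∀ x, H t x < 0 → IsLocalMin (H t) x →
      ∃ h', HasDerivAt (fun s => H s x) h' t ∧ Λ * H t x < h') :
    ∀ t ∈ Set.Icc 0 T, ∀ x, 0 ≤ H t x := by
  intro t₁ ht₁ x₁
  by_contra! hneg
  set W : ℝ × Plane → ℝ := fun p => Real.exp (-Λ * p.1) * H p.1 p.2
  have hWc : ContinuousOn W (Set.Icc 0 T ×ˢ closedCell) := by
    refine ContinuousOn.mul (by fun_prop) (hcont.mono ?_)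
    exact Set.prod_mono le_rfl (Set.subset_univ _)
  obtain ⟨⟨t, x⟩, ⟨ht, hx⟩, hmin⟩ := (isCompact_Icc.prod isCompact_closedCell).exists_isMinOn
    ⟨(t₁, fractPart x₁), ht₁, fractPart_mem_closedCell x₁⟩ hWc
  have hmin' : ∀ s ∈ Set.Icc 0 T, ∀ y, W (t, x) ≤ W (s, y) := fun s hs y => by
    have := isMinOn_iff.1 hmin (s, fractPart y) ⟨hs, fractPart_mem_closedCell y⟩
    simpa only [W, (hper s).fractPart_eq] using this
  have hWneg : W (t, x) < 0 := (hmin' t₁ ht₁ x₁).trans_lt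
    (mul_neg_of_pos_of_neg (Real.exp_pos _) hneg)
  have hHneg : H t x < 0 := by
    by_contra! h
    exact absurd hWneg (not_lt.2 (mul_nonneg (Real.exp_pos _).le h))
  have ht0 : 0 < t := by
    rcases ht.1.eq_or_lt with h | h
    · exact absurd (hinit x) (not_le.2 (h ▸ hHneg))
    · exact h
  have hloc : IsLocalMin (H t) x := Filter.Eventually.of_forall fun y => by
    have := hmin' t ht y
    exact le_of_mul_le_mul_left this (Real.exp_pos _)
  obtain ⟨h', hd, hlt⟩ := hstep t ⟨ht0, ht.2⟩ x hHneg hloc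
  have hdW : HasDerivAt (fun s => W (s, x)) (Real.exp (-Λ * t) * (h' - Λ * H t x)) t := by
    have h1 : HasDerivAt (fun s => Real.exp (-Λ * s)) (Real.exp (-Λ * t) * -Λ) t := by
      simpa using ((hasDerivAt_id t).const_mul (-Λ)).exp
    exact (h1.mul hd).congr_deriv (by ring)
  have hpos : 0 < Real.exp (-Λ * t) * (h' - Λ * H t x) :=
    mul_pos (Real.exp_pos _) (by linarith)
  have hev := (hasDerivAt_iff_tendsto_slope_left_right.1 hdW).1.eventually (lt_mem_nhds hpos)
  have hev2 : ∀ᶠ s in nhdsWithin t (Set.Iio t), s ∈ Set.Ioo 0 t :=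
    Ioo_mem_nhdsLT ht0
  obtain ⟨s, hs1, hs2⟩ := (hev.and hev2).exists
  have h3 := hmin' s ⟨hs2.1.le, hs2.2.le.trans ht.2⟩ x
  rw [slope_def_field] at hs1
  have h4 : (W (s, x) - W (t, x)) / (s - t) ≤ 0 :=
    div_nonpos_of_nonneg_of_nonpos (by linarith) (by linarith [hs2.2])
  linarith

/-! ### Calculus of the Laplacian. -/

section Laplacian

theorem laplacian_norm_sq {F : Plane → Plane} (hF : ContDiff ℝ 2 F) (x : Plane) :
    (Δ (fun x => ‖F x‖ ^ 2)) x = 2 * inner ℝ (F x) ((Δ F) x) + 2 * gradSq F x := by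
  rw [laplacian_eq_sum_pd (hF.norm_sq ℝ), sum_pd_pd_norm_sq hF]

theorem laplacian_comp_add {V : Type*} [NormedAddCommGroup V] [NormedSpace ℝ V] {F : Plane → V}
    (hF : ContDiff ℝ 2 F) (h x : Plane) : (Δ (fun x => F (x + h))) x = (Δ F) (x + h) := by
  have : ContDiff ℝ 2 fun x => F (x + h) := hF.comp (contDiff_id.add contDiff_const)
  rw [laplacian_eq_sum_pd this, laplacian_eq_sum_pd hF]
  refine Finset.sum_congr rfl fun i _ => ?_
  rw [pd_comp_add, pd_comp_add]

theorem laplacian_mul {f g : Plane → ℝ} (hf : ContDiff ℝ 2 f) (hg : ContDiff ℝ 2 g) (x : Plane) :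
    (Δ (fun x => f x * g x)) x
      = (Δ f) x * g x + 2 * (∑ i, pd i f x * pd i g x) + f x * (Δ g) x := by
  rw [laplacian_eq_sum_pd (hf.mul hg), laplacian_eq_sum_pd hf, laplacian_eq_sum_pd hg]
  simp only [pd_pd_mul hf hg, Fin.sum_univ_two]
  ring

theorem laplacian_fun_add {f g : Plane → ℝ} (hf : ContDiff ℝ 2 f) (hg : ContDiff ℝ 2 g)
    (x : Plane) : (Δ (fun x => f x + g x)) x = (Δ f) x + (Δ g) x :=
  hf.contDiffAt.laplacian_add hg.contDiffAt

theorem laplacian_fun_sub {f g : Plane → ℝ} (hf : ContDiff ℝ 2 f) (hg : ContDiff ℝ 2 g)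
    (x : Plane) : (Δ (fun x => f x - g x)) x = (Δ f) x - (Δ g) x :=
  hf.contDiffAt.laplacian_sub hg.contDiffAt

theorem laplacian_const_mul {f : Plane → ℝ} (hf : ContDiff ℝ 2 f) (c : ℝ)
    (x : Plane) : (Δ (fun x => c * f x)) x = c * (Δ f) x :=
  InnerProductSpace.laplacian_smul c hf.contDiffAt

theorem laplacian_fun_const (c : ℝ) (x : Plane) : (Δ (fun _ : Plane => c)) x = 0 := by
  simp [laplacian_eq_sum_pd (F := fun _ : Plane => c) contDiff_const, pd_const]

theorem laplacian_nonneg_of_isLocalMin {f : Plane → ℝ} {x : Plane} (hf : ContDiff ℝ 2 f)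
    (h : IsLocalMin f x) : 0 ≤ (Δ f) x := by
  rw [laplacian_eq_sum_pd hf]
  exact Finset.sum_nonneg fun i _ => pd_pd_nonneg_of_isLocalMin hf h i

theorem continuous_laplacian {V : Type*} [NormedAddCommGroup V] [NormedSpace ℝ V] {F : Plane → V}
    (hF : ContDiff ℝ 2 F) : Continuous (Δ F) := by
  have : Δ F = fun x => ∑ i, pd i (pd i F) x := funext fun x => laplacian_eq_sum_pd hF x
  rw [this]
  exact continuous_finsetSum _ fun i _ => continuous_pd_pd hF i

theorem gradSq_nonneg (F : Plane → Plane) (x : Plane) : 0 ≤ gradSq F x :=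
  Finset.sum_nonneg fun _ _ => by positivity

theorem continuous_gradSq {F : Plane → Plane} (hF : ContDiff ℝ 1 F) : Continuous (gradSq F) :=
  continuous_finsetSum _ fun i _ => (continuous_pd hF i).norm.pow 2

end Laplacian

/-! ### The gradient bound. -/

namespace IsSolution

variable {ε : ℝ} {u₀ : Torus → Plane} {u : ℝ → Torus → Plane}

theorem continuousOn_lift (hu : IsSolution ε u₀ u) :
    ContinuousOn (fun p : ℝ × Plane => lift (u p.1) p.2) (Set.Ici 0 ×ˢ Set.univ) := by
  have hπ : Continuous (fun p : ℝ × Plane =>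
      ((p.1, fun i => ((p.2 i : ℝ) : UnitAddCircle)) : ℝ × Torus)) := by
    refine continuous_fst.prodMk (continuous_pi fun i => ?_)
    exact (AddCircle.continuous_mk' (1 : ℝ)).comp (by fun_prop)
  exact hu.continuousOn.comp hπ.continuousOn fun p hp => ⟨hp.1, Set.mem_univ _⟩

theorem hasDerivAt_time (hu : IsSolution ε u₀ u) {t : ℝ} (ht : 0 < t) (x : Plane) :
    HasDerivAt (fun s => lift (u s) x)
      (ε ^ 2 • (Δ (lift (u t))) x + (1 - ‖lift (u t) x‖ ^ 2) • lift (u t) x) t := by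
  have h := (hu.differentiableAt_time t ht x).hasDerivAt
  rwa [eq_add_of_sub_eq' (hu.equation t ht x)] at h

theorem hasDerivAt_norm_sq (hu : IsSolution ε u₀ u) {t : ℝ} (ht : 0 < t) (x : Plane) :
    HasDerivAt (fun s => ‖lift (u s) x‖ ^ 2)
      (ε ^ 2 * (Δ (fun y => ‖lift (u t) y‖ ^ 2)) x - 2 * ε ^ 2 * gradSq (lift (u t)) x
        + 2 * (1 - ‖lift (u t) x‖ ^ 2) * ‖lift (u t) x‖ ^ 2) t := by
  refine (hu.hasDerivAt_time ht x).norm_sq.congr_deriv ?_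
  rw [laplacian_norm_sq (hu.contDiff_space t ht), inner_add_right, real_inner_smul_right,
    real_inner_smul_right, real_inner_self_eq_norm_sq]
  ring

/-- Two-point form of the comparison of `|∇u|²` with `e^{2t} - (e^{2t} - 1) |u|²`. -/
theorem norm_sub_sq_le (hu : IsSolution ε u₀ u) {K : ℝ} (hK : 0 ≤ K)
    (hLip : ∀ x y, ‖lift u₀ y - lift u₀ x‖ ^ 2 ≤ K * ‖y - x‖ ^ 2)
    {t : ℝ} (ht : 0 ≤ t) (x h : Plane) :
    ‖lift (u t) (x + h) - lift (u t) x‖ ^ 2 ≤ K * ‖h‖ ^ 2 * (Real.exp (2 * t)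
      - (Real.exp (2 * t) - 1) / 2 * (‖lift (u t) x‖ ^ 2 + ‖lift (u t) (x + h)‖ ^ 2)) := by
  set κ := K * ‖h‖ ^ 2 with hκ
  have hκ0 : 0 ≤ κ := by positivity
  -- Finite differences replace `∇u`: an equation for `|∇u|²` would involve third space derivatives,
  -- and `∇u` would have to be continuous up to `t = 0`; neither is part of `IsSolution`. The two
  -- values of `|u|²` are averaged to keep the expression symmetric.
  set H : ℝ → Plane → ℝ := fun t x => κ * (Real.exp (2 * t)
      - (Real.exp (2 * t) - 1) / 2 * (‖lift (u t) x‖ ^ 2 + ‖lift (u t) (x + h)‖ ^ 2))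
      - ‖lift (u t) (x + h) - lift (u t) x‖ ^ 2 with hH
  suffices 0 ≤ H t x by simpa [hH] using this
  have hcl := hu.continuousOn_lift
  have hcl' : ContinuousOn (fun p : ℝ × Plane => lift (u p.1) (p.2 + h))
      (Set.Ici 0 ×ˢ Set.univ) :=
    hcl.comp (f := fun p : ℝ × Plane => (p.1, p.2 + h)) (by fun_prop) fun p hp =>
      ⟨hp.1, Set.mem_univ _⟩
  -- With `A`, `B` the two values of `|u|²`, the reaction terms contribute `(2 - A - B)H` plus a
  -- nonnegative multiple of `(A - B)²`. Where `H < 0` this is at least `2H`, so any `Λ > 2` works.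
  refine nonneg_of_strict_supersolution (T := t) (Λ := 3) ?_ ?_ ?_ ?_ t ⟨ht, le_rfl⟩ x
  · intro t x y hxy
    simp only [hH]
    have e : lift (u t) (y + h) = lift (u t) (x + h) := (isPeriodic_lift (u t)).comp_add h hxy
    rw [isPeriodic_lift (u t) hxy, e]
  · refine ContinuousOn.mono ?_ (Set.prod_mono Set.Icc_subset_Ici_self le_rfl)
    have he : ContinuousOn (fun p : ℝ × Plane => Real.exp (2 * p.1))
      (Set.Ici 0 ×ˢ Set.univ) := by fun_prop
    exact (((he.sub (((he.sub continuousOn_const).div_const 2).mul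
      ((hcl.norm.pow 2).add (hcl'.norm.pow 2)))).const_mul κ)).sub ((hcl'.sub hcl).norm.pow 2)
  · intro x
    have := hLip x (x + h)
    simp only [hH, hu.initial]
    simp only [add_sub_cancel_left] at this
    simpa [hκ] using this
  · intro t ht x hneg hmin
    have hF := hu.contDiff_space t ht.1
    set F := lift (u t) with hFdef
    have hF' : ContDiff ℝ 2 fun x => F (x + h) := hF.comp (contDiff_id.add contDiff_const)
    have hm : ContDiff ℝ 2 fun x => ‖F x‖ ^ 2 := hF.norm_sq ℝ
    have hm' : ContDiff ℝ 2 fun x => ‖F (x + h)‖ ^ 2 := hF'.norm_sq ℝ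
    have hd : ContDiff ℝ 2 fun x => F (x + h) - F x := hF'.sub hF
    have hd2 : ContDiff ℝ 2 fun x => ‖F (x + h) - F x‖ ^ 2 := hd.norm_sq ℝ
    set E := Real.exp (2 * t)
    have hHeq : H t = fun x => (-(κ * (E - 1) / 2) * (‖F x‖ ^ 2 + ‖F (x + h)‖ ^ 2)
        - ‖F (x + h) - F x‖ ^ 2) + κ * E := by
      ext x; simp only [hH, ← hFdef]; ring
    have hHs : ContDiff ℝ 2 (H t) := by
      rw [hHeq]
      exact ((contDiff_const.mul (hm.add hm')).sub hd2).add contDiff_const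
    have hΔH : (Δ (H t)) x = -(κ * (E - 1) / 2) * ((Δ (fun x => ‖F x‖ ^ 2)) x
        + (Δ (fun x => ‖F x‖ ^ 2)) (x + h)) - (Δ (fun x => ‖F (x + h) - F x‖ ^ 2)) x := by
      rw [hHeq, laplacian_fun_add ((contDiff_const.mul (hm.add hm')).sub hd2) contDiff_const,
        laplacian_fun_const, laplacian_fun_sub (contDiff_const.mul (hm.add hm')) hd2,
        laplacian_const_mul (hm.add hm'), laplacian_fun_add hm hm',
        laplacian_comp_add hm h x, add_zero]
    have hΔ := laplacian_nonneg_of_isLocalMin hHs hmin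
    have dE : HasDerivAt (fun s => Real.exp (2 * s)) (2 * E) t := by
      have := ((hasDerivAt_id t).const_mul 2).exp
      simpa [E, mul_comm] using this
    have da := hu.hasDerivAt_norm_sq ht.1 x
    have db := hu.hasDerivAt_norm_sq ht.1 (x + h)
    have dd := ((hu.hasDerivAt_time ht.1 (x + h)).sub (hu.hasDerivAt_time ht.1 x)).norm_sq
    refine ⟨_, ((dE.sub (((dE.sub_const 1).div_const 2).mul (da.add db))).const_mul κ).sub dd, ?_⟩
    simp only [Pi.add_apply, Pi.sub_apply, ← hFdef]
    rw [hΔH, laplacian_norm_sq hd] at hΔ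
    have hLd : (Δ (fun x => F (x + h) - F x)) x = (Δ F) (x + h) - (Δ F) x := by
      rw [← laplacian_comp_add hF]
      exact hF'.contDiffAt.laplacian_sub hF.contDiffAt
    rw [hLd] at hΔ
    have hgd := gradSq_nonneg (fun x => F (x + h) - F x) x
    have hga := gradSq_nonneg F x
    have hgb := gradSq_nonneg F (x + h)
    have hE1 : 1 ≤ E := Real.one_le_exp (by linarith [ht.1])
    have hab : ‖F (x + h) - F x‖ ^ 2
        = ‖F (x + h)‖ ^ 2 - 2 * inner ℝ (F (x + h)) (F x) + ‖F x‖ ^ 2 := norm_sub_sq_real _ _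
    have hreac : inner ℝ (F (x + h) - F x) (ε ^ 2 • (Δ F) (x + h)
        + (1 - ‖F (x + h)‖ ^ 2) • F (x + h) - (ε ^ 2 • (Δ F) x + (1 - ‖F x‖ ^ 2) • F x))
        = ε ^ 2 * inner ℝ (F (x + h) - F x) ((Δ F) (x + h) - (Δ F) x)
          + (1 - ‖F (x + h)‖ ^ 2) * (‖F (x + h)‖ ^ 2 - inner ℝ (F (x + h)) (F x))
          + (1 - ‖F x‖ ^ 2) * (‖F x‖ ^ 2 - inner ℝ (F (x + h)) (F x)) := by
      simp only [inner_add_right, inner_sub_right, inner_sub_left, real_inner_smul_right,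
        real_inner_self_eq_norm_sq, real_inner_comm (F (x + h)) (F x)]
      ring
    rw [hreac]
    have hHx : H t x = κ * (E - (E - 1) / 2 * (‖F x‖ ^ 2 + ‖F (x + h)‖ ^ 2))
      - ‖F (x + h) - F x‖ ^ 2 := rfl
    rw [hab] at hHx
    have hA : 0 ≤ ‖F x‖ ^ 2 := by positivity
    have hB : 0 ≤ ‖F (x + h)‖ ^ 2 := by positivity
    generalize ‖F x‖ ^ 2 = A at *
    generalize ‖F (x + h)‖ ^ 2 = B at *
    generalize inner ℝ (F (x + h)) (F x) = c at *
    generalize inner ℝ (F (x + h) - F x) ((Δ F) (x + h) - (Δ F) x) = I at *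
    generalize gradSq (fun x => F (x + h) - F x) x = gd at *
    generalize gradSq F x = ga at *
    generalize gradSq F (x + h) = gb at *
    generalize (Δ (fun x => ‖F x‖ ^ 2)) x = La at *
    generalize (Δ (fun x => ‖F x‖ ^ 2)) (x + h) = Lb at *
    have p1 : 0 ≤ ε ^ 2 * (-(κ * (E - 1) / 2) * (La + Lb) - (2 * I + 2 * gd)) :=
      mul_nonneg (sq_nonneg _) hΔ
    have p2 : 0 ≤ ε ^ 2 * (κ * (E - 1) * (ga + gb)) :=
      mul_nonneg (sq_nonneg _) (mul_nonneg (mul_nonneg hκ0 (by linarith)) (by linarith))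
    have p3 : 0 ≤ ε ^ 2 * gd := mul_nonneg (sq_nonneg _) hgd
    have p4 : 0 ≤ (κ * (E - 1) / 2 + 1) * (A - B) ^ 2 :=
      mul_nonneg (by nlinarith) (sq_nonneg _)
    have p5 : 0 ≤ (A + B) * -(H t x) := mul_nonneg (by linarith) (by linarith)
    rw [hHx] at p5 hneg ⊢
    nlinarith [p1, p2, p3, p4, p5, hneg]

/-- `|∂ᵢu|² ≤ K (e^{2t} - (e^{2t} - 1) |u|²)`, where `√K` is a Lipschitz constant of `u₀`. -/
theorem norm_pd_sq_le (hu : IsSolution ε u₀ u) {K : ℝ} (hK : 0 ≤ K)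
    (hLip : ∀ x y, ‖lift u₀ y - lift u₀ x‖ ^ 2 ≤ K * ‖y - x‖ ^ 2)
    {t : ℝ} (ht : 0 < t) (x : Plane) (i : Fin 2) :
    ‖pd i (lift (u t)) x‖ ^ 2 ≤ K * (Real.exp (2 * t)
      - (Real.exp (2 * t) - 1) * ‖lift (u t) x‖ ^ 2) := by
  have hF := hu.contDiff_space t ht
  set F := lift (u t)
  have hd := hasDerivAt_line (differentiable_of_contDiff_two hF) x i 0
  simp only [zero_smul, add_zero] at hd
  have h1 := (hd.tendsto_slope.norm).pow 2
  have hc : Continuous fun r : ℝ => K * (Real.exp (2 * t)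
      - (Real.exp (2 * t) - 1) / 2 * (‖F x‖ ^ 2
        + ‖F (x + r • EuclideanSpace.single i (1 : ℝ))‖ ^ 2)) := by
    have := hF.continuous
    fun_prop
  have h2 := (hc.tendsto 0).mono_left (nhdsWithin_le_nhds (s := {(0 : ℝ)}ᶜ))
  have h3 := le_of_tendsto_of_tendsto h1 h2 (by
    filter_upwards [self_mem_nhdsWithin] with r hr
    have hr0 : (r : ℝ) ≠ 0 := hr
    have := hu.norm_sub_sq_le hK hLip ht.le x (r • EuclideanSpace.single i (1 : ℝ))
    rw [slope_def_module]
    simp only [zero_smul, add_zero, sub_zero, norm_smul, norm_inv]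
    simp only [norm_smul, PiLp.norm_single, norm_one, mul_one] at this
    have hrp : 0 < ‖r‖ ^ 2 := by positivity
    rw [mul_pow, inv_pow, inv_mul_le_iff₀ hrp]
    calc _ ≤ _ := this
      _ = _ := by ring)
  refine h3.trans (le_of_eq ?_)
  simp only [zero_smul, add_zero]
  ring

end IsSolution

/-! ### The lower barrier for the modulus. -/

namespace IsSolution

variable {ε : ℝ} {u₀ : Torus → Plane} {u : ℝ → Torus → Plane}

/-- If `d ≤ |u₀|²` is a smooth minorant which is nonnegative, then a slightly decreased multiple
`q` of `d` satisfies `q (e^{2t} - (e^{2t} - 1) |u|²) ≤ |u|²`. -/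
theorem barrier_le (hu : IsSolution ε u₀ u) {K M : ℝ} (hK : 0 < K) (hM : 0 ≤ M)
    (hLip : ∀ x y, ‖lift u₀ y - lift u₀ x‖ ^ 2 ≤ K * ‖y - x‖ ^ 2)
    {d : Plane → ℝ} (hd : ContDiff ℝ 2 d) (hdper : IsPeriodic d) (hd0 : ∀ x, 0 ≤ d x)
    (hdle : ∀ x, d x ≤ ‖lift u₀ x‖ ^ 2) (hgrad : ∀ i x, (pd i d x) ^ 2 ≤ M * d x)
    (hlap : ∀ x, |(Δ d) x| ≤ M) {t : ℝ} (ht : 0 ≤ t) (x : Plane) :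
    (Real.exp (-((8 * K + 4 * M) * ε ^ 2 * (Real.exp (2 * t) - 1) / 2)) * d x
        - (8 * K + 4 * M) * ε ^ 2 * t)
      * (Real.exp (2 * t) - (Real.exp (2 * t) - 1) * ‖lift (u t) x‖ ^ 2)
      ≤ ‖lift (u t) x‖ ^ 2 := by
  -- The diffusion errors are at most `ε²N` times `4K(1 + (E - 1)Ad) + 4(K + M)(E - 1)Ad + M`, where
  -- `A` is the exponential factor in `q`. The decrease of `q` offers `Bε²N(EAd + 1)`: the
  -- exponential absorbs the terms with `Ad`, which fix `B`, and the linear term absorbs the rest.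
  set B := 8 * K + 4 * M with hB
  have hB0 : 0 ≤ B := by positivity
  set q : ℝ → Plane → ℝ := fun t x =>
    Real.exp (-(B * ε ^ 2 * (Real.exp (2 * t) - 1) / 2)) * d x - B * ε ^ 2 * t with hq
  -- Here `H = m - qN`. For `q` constant in time the reaction terms contribute exactly `2(1 - m)H`,
  -- again at least `2H` where `H < 0`.
  set H : ℝ → Plane → ℝ := fun t x => ‖lift (u t) x‖ ^ 2 * ((Real.exp (2 * t) - 1) * q t x + 1)
    - Real.exp (2 * t) * q t x with hH
  suffices 0 ≤ H t x by
    simp only [hH, hq] at this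
    linarith
  have hcl := hu.continuousOn_lift
  refine nonneg_of_strict_supersolution (T := t) (Λ := 3) ?_ ?_ ?_ ?_ t ⟨ht, le_rfl⟩ x
  · intro t x y hxy
    simp only [hH, hq]
    rw [isPeriodic_lift (u t) hxy, hdper hxy]
  · refine ContinuousOn.mono ?_ (Set.prod_mono Set.Icc_subset_Ici_self le_rfl)
    have hdc := hd.continuous
    have hqc : ContinuousOn (fun p : ℝ × Plane => q p.1 p.2) (Set.Ici 0 ×ˢ Set.univ) := by
      simp only [hq]; fun_prop
    have he : ContinuousOn (fun p : ℝ × Plane => Real.exp (2 * p.1))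
      (Set.Ici 0 ×ˢ Set.univ) := by fun_prop
    exact ((hcl.norm.pow 2).mul (((he.sub continuousOn_const).mul hqc).add
      continuousOn_const)).sub (he.mul hqc)
  · intro x
    have := hdle x
    simpa [hH, hq, hu.initial] using this
  · intro t ht x hneg hmin
    have hF := hu.contDiff_space t ht.1
    have hgK : ∀ i, ‖pd i (lift (u t)) x‖ ^ 2 ≤ K * (Real.exp (2 * t)
      - (Real.exp (2 * t) - 1) * ‖lift (u t) x‖ ^ 2) := hu.norm_pd_sq_le hK.le hLip ht.1 x
    have dm := hu.hasDerivAt_norm_sq ht.1 x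
    have dE : HasDerivAt (fun s => Real.exp (2 * s)) (2 * Real.exp (2 * t)) t := by
      have := ((hasDerivAt_id t).const_mul 2).exp
      simpa [mul_comm] using this
    have dA := (((dE.sub_const 1).const_mul (B * ε ^ 2)).div_const 2).neg.exp
    have dq : HasDerivAt (fun s => q s x) _ t :=
      (dA.mul_const (d x)).sub ((hasDerivAt_id t).const_mul (B * ε ^ 2))
    refine ⟨_, (dm.mul (((dE.sub_const 1).mul dq).add_const 1)).sub (dE.mul dq), ?_⟩
    have hE1 : 1 ≤ Real.exp (2 * t) := Real.one_le_exp (by linarith [ht.1])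
    have hAle : Real.exp (-(B * ε ^ 2 * (Real.exp (2 * t) - 1) / 2)) ≤ 1 := by
      rw [Real.exp_le_one_iff]
      have : 0 ≤ B * ε ^ 2 * (Real.exp (2 * t) - 1) :=
        mul_nonneg (by positivity) (by linarith)
      linarith
    have hA0 := Real.exp_pos (-(B * ε ^ 2 * (Real.exp (2 * t) - 1) / 2))
    have hqx : q t x = Real.exp (-(B * ε ^ 2 * (Real.exp (2 * t) - 1) / 2)) * d x
      - B * ε ^ 2 * t := rfl
    have hb0 : 0 ≤ B * ε ^ 2 * t := mul_nonneg (by positivity) ht.1.le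
    have hHx : H t x = ‖lift (u t) x‖ ^ 2 * ((Real.exp (2 * t) - 1) * q t x + 1)
      - Real.exp (2 * t) * q t x := rfl
    have hHt : H t = fun x => ‖lift (u t) x‖ ^ 2 * ((Real.exp (2 * t) - 1) *
        Real.exp (-(B * ε ^ 2 * (Real.exp (2 * t) - 1) / 2)) * d x
          + (1 - (Real.exp (2 * t) - 1) * (B * ε ^ 2 * t)))
        - (Real.exp (2 * t) * Real.exp (-(B * ε ^ 2 * (Real.exp (2 * t) - 1) / 2)) * d x
          - Real.exp (2 * t) * (B * ε ^ 2 * t)) := by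
      ext x; simp only [hH, hq]; ring
    set F := lift (u t) with hFdef
    simp only [Pi.mul_apply]
    generalize hAdef : Real.exp (-(B * ε ^ 2 * (Real.exp (2 * t) - 1) / 2)) = A at *
    generalize hEdef : Real.exp (2 * t) = E at *
    have hm : ContDiff ℝ 2 fun x => ‖F x‖ ^ 2 := hF.norm_sq ℝ
    have c1 : ContDiff ℝ 2 fun x => (E - 1) * A * d x := contDiff_const.mul hd
    have c2 : ContDiff ℝ 2 fun x => (E - 1) * A * d x + (1 - (E - 1) * (B * ε ^ 2 * t)) :=
      c1.add contDiff_const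
    have c3 : ContDiff ℝ 2 fun x => E * A * d x := contDiff_const.mul hd
    have c4 : ContDiff ℝ 2 fun x => E * A * d x - E * (B * ε ^ 2 * t) := c3.sub contDiff_const
    have hHs : ContDiff ℝ 2 (H t) := by
      rw [hHt]; exact (hm.mul c2).sub c4
    have hΔ := laplacian_nonneg_of_isLocalMin hHs hmin
    rw [hHt, laplacian_fun_sub (hm.mul c2) c4, laplacian_mul hm c2,
      laplacian_fun_add c1 contDiff_const, laplacian_fun_sub c3 contDiff_const,
      laplacian_const_mul hd, laplacian_const_mul hd, laplacian_fun_const,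
      laplacian_fun_const] at hΔ
    simp only [pd_add_const, pd_const_mul (differentiable_of_contDiff_two hd)] at hΔ
    set N := E - (E - 1) * ‖F x‖ ^ 2 with hN
    have hm0 : 0 ≤ ‖F x‖ ^ 2 := by positivity
    have hd0x := hd0 x
    have hlapx := abs_le.1 (hlap x)
    have hHN : H t x = ‖F x‖ ^ 2 - q t x * N := by rw [hHx, hN]; ring
    have hN0' : 0 ≤ N := nonneg_of_mul_nonneg_right ((sq_nonneg _).trans (hgK 0)) hK
    have hqpos : 0 < q t x := by
      by_contra! h
      have := mul_nonneg (neg_nonneg.2 h) hN0'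
      linarith
    have hN0 : 0 < N := by
      refine lt_of_le_of_ne hN0' fun h => ?_
      rw [← h] at hHN
      linarith
    have hqd : q t x ≤ A * d x := by rw [hqx]; linarith
    have hAd0 : 0 ≤ A * d x := by positivity
    have hmq : ‖F x‖ ^ 2 ≤ A * d x * N := by
      have := mul_le_mul_of_nonneg_right hqd hN0'
      linarith
    -- Where `H < 0`, `m ≤ AdN`; hence `|∂ᵢm|² ≤ 4m|∂ᵢu|²` is at most `4K·Ad·N²`. Combined with
    -- `|∂ᵢd|² ≤ Md` and `4KM ≤ (K + M)²`, the cross term carries a full factor `d`, so that the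
    -- decay of the exponential can absorb it.
    have hcross : ∀ i, |pd i (fun x => ‖F x‖ ^ 2) x * (A * pd i d x)| ≤ (K + M) * (A * d x) * N := by
      intro i
      refine abs_le_of_sq_le_sq ?_ (by positivity)
      have h1 : (pd i (fun x => ‖F x‖ ^ 2) x) ^ 2 ≤ 4 * (A * d x * N) * (K * N) := by
        rw [pd_norm_sq (differentiable_of_contDiff_two hF), mul_pow]
        have h2 : (inner ℝ (F x) (pd i F x)) ^ 2 ≤ ‖F x‖ ^ 2 * ‖pd i F x‖ ^ 2 := by
          rw [← mul_pow, ← sq_abs]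
          exact pow_le_pow_left₀ (abs_nonneg _) (abs_real_inner_le_norm _ _) 2
        have h3 : ‖F x‖ ^ 2 * ‖pd i F x‖ ^ 2 ≤ (A * d x * N) * (K * N) :=
          mul_le_mul hmq (hgK i) (by positivity) (by positivity)
        linarith
      have h2 : (A * pd i d x) ^ 2 ≤ A * (M * (A * d x)) := by
        have := mul_le_mul_of_nonneg_left (hgrad i x) (sq_nonneg A)
        calc _ = A ^ 2 * (pd i d x) ^ 2 := by ring
          _ ≤ _ := this
          _ = _ := by ring
      have h2' : (A * pd i d x) ^ 2 ≤ M * (A * d x) :=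
        h2.trans (mul_le_of_le_one_left (by positivity) hAle)
      rw [mul_pow]
      calc _ ≤ (4 * (A * d x * N) * (K * N)) * (M * (A * d x)) :=
            mul_le_mul h1 h2' (by positivity) (by positivity)
        _ = (4 * K * M) * (A * d x * N) ^ 2 := by ring
        _ ≤ (K + M) ^ 2 * (A * d x * N) ^ 2 :=
            mul_le_mul_of_nonneg_right (by nlinarith [sq_nonneg (K - M)]) (sq_nonneg _)
        _ = _ := by ring
    have hg : gradSq F x ≤ 2 * K * N := by
      rw [gradSq_eq, Fin.sum_univ_two]
      linarith [hgK 0, hgK 1]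
    have hs : 0 ≤ E - 1 := by linarith
    have hε : 0 ≤ ε ^ 2 := sq_nonneg _
    have hsum : |∑ i, pd i (fun x => ‖F x‖ ^ 2) x * (A * pd i d x)|
        ≤ 2 * ((K + M) * (A * d x) * N) := by
      rw [Fin.sum_univ_two]
      exact (abs_add_le _ _).trans (by linarith [hcross 0, hcross 1])
    have hsum' : ∑ i, pd i (fun x => ‖F x‖ ^ 2) x * ((E - 1) * A * pd i d x)
        = (E - 1) * ∑ i, pd i (fun x => ‖F x‖ ^ 2) x * (A * pd i d x) := by
      rw [Finset.mul_sum]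
      exact Finset.sum_congr rfl fun i _ => by ring
    rw [hsum'] at hΔ
    generalize ∑ i, pd i (fun x => ‖F x‖ ^ 2) x * (A * pd i d x) = S at *
    generalize (Δ (fun x => ‖F x‖ ^ 2)) x = Lm at *
    generalize (Δ d) x = Ld at *
    generalize gradSq F x = g at *
    have p1 := mul_nonneg hε hΔ
    have hcoef : (E - 1) * A * d x + (1 - (E - 1) * (B * ε ^ 2 * t)) = (E - 1) * q t x + 1 := by
      rw [hqx]; ring
    rw [hcoef] at p1
    have p2 : 0 ≤ ‖F x‖ ^ 2 * -(H t x) := mul_nonneg hm0 (by linarith)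
    have p3 : 0 ≤ ε ^ 2 * ((1 + (E - 1) * q t x) * (2 * K * N - g)) :=
      mul_nonneg hε (mul_nonneg (by positivity) (by linarith))
    have p4 : 0 ≤ ε ^ 2 * ((E - 1) * (2 * ((K + M) * (A * d x) * N) - S)) :=
      mul_nonneg hε (mul_nonneg hs (by linarith [(abs_le.1 hsum).2]))
    have p5 : 0 ≤ ε ^ 2 * (N * (A * (Ld + M))) :=
      mul_nonneg hε (mul_nonneg hN0' (mul_nonneg hA0.le (by linarith)))
    have p6 : 0 ≤ ε ^ 2 * (N * ((1 - A) * M)) :=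
      mul_nonneg hε (mul_nonneg hN0' (mul_nonneg (by linarith) hM))
    have p7 : 0 ≤ ε ^ 2 * (N * (K * ((E - 1) * (A * d x - q t x)))) :=
      mul_nonneg hε (mul_nonneg hN0' (mul_nonneg hK.le (mul_nonneg hs (by linarith))))
    have p8 : 0 ≤ ε ^ 2 * (N * (B * (A * d x))) := by positivity
    have p9 : 0 ≤ ε ^ 2 * (N * (4 * K + 3 * M)) := by positivity
    rw [hHN] at p2 hneg ⊢
    clear_value q B H N F
    generalize q t x = Q at *
    generalize d x = D at *
    generalize ‖F x‖ ^ 2 = m at *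
    subst hN hB
    linarith only [p1, p2, p3, p4, p5, p6, p7, p8, p9, hneg]

end IsSolution

/-! ### Integration over the unit cell -/

section UnitCell

open MeasureTheory

/-- The coordinates on the plane. -/
def coordEquiv : Plane ≃ᵐ ℝ × ℝ :=
  (MeasurableEquiv.toLp 2 (Fin 2 → ℝ)).symm.trans MeasurableEquiv.finTwoArrow

theorem measurePreserving_coordEquiv : MeasurePreserving coordEquiv volume volume :=
  (EuclideanSpace.volume_preserving_symm_measurableEquiv_toLp (Fin 2)).trans
    (volume_preserving_finTwoArrow ℝ)

theorem coordEquiv_preimage : coordEquiv ⁻¹' (Set.Ico 0 1 ×ˢ Set.Ico 0 1) = unitCell := by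
  ext x
  simp only [unitCell, Set.mem_preimage, Set.mem_prod, Set.mem_ofPred_eq, Fin.forall_fin_two]
  rfl

theorem measurableSet_unitCell : MeasurableSet unitCell := by
  rw [← coordEquiv_preimage]
  exact coordEquiv.measurable (measurableSet_Ico.prod measurableSet_Ico)

theorem volume_unitCell : volume unitCell = 1 := by
  rw [← coordEquiv_preimage, measurePreserving_coordEquiv.measure_preimage_equiv,
    Measure.volume_eq_prod, Measure.prod_prod]
  simp

instance : IsProbabilityMeasure (volume.restrict unitCell) :=
  ⟨by rw [Measure.restrict_apply_univ, volume_unitCell]⟩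

theorem integrableOn_unitCell {V : Type*} [NormedAddCommGroup V] {F : Plane → V}
    (hF : Continuous F) : IntegrableOn F unitCell :=
  (hF.continuousOn.integrableOn_compact isCompact_closedCell).mono_set unitCell_subset_closedCell

theorem continuous_mk_plane : Continuous fun p : ℝ × ℝ => (!₂[p.1, p.2] : Plane) := by
  refine (PiLp.continuous_toLp 2 _).comp (continuous_pi fun i => ?_)
  fin_cases i
  · exact continuous_fst
  · exact continuous_snd

variable {V : Type*} [NormedAddCommGroup V] [NormedSpace ℝ V]

theorem integral_unitCell_eq_prod (F : Plane → V) :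
    ∫ x in unitCell, F x = ∫ p in (Set.Ico (0 : ℝ) 1 ×ˢ Set.Ico (0 : ℝ) 1), F !₂[p.1, p.2] := by
  rw [← coordEquiv_preimage, ← measurePreserving_coordEquiv.setIntegral_preimage_emb
    coordEquiv.measurableEmbedding]
  refine integral_congr_ae (Filter.Eventually.of_forall fun x => ?_)
  change F x = F (coordEquiv.symm (coordEquiv x))
  rw [coordEquiv.symm_apply_apply]

theorem integral_Ico_eq_interval (f : ℝ → V) : ∫ a in Set.Ico (0 : ℝ) 1, f a = ∫ a in 0..1, f a := by
  rw [intervalIntegral.integral_of_le zero_le_one, integral_Ico_eq_integral_Ioc]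

theorem integral_unitCell {F : Plane → V} (hF : Continuous F) :
    ∫ x in unitCell, F x = ∫ a in (0 : ℝ)..1, ∫ b in (0 : ℝ)..1, F !₂[a, b] := by
  rw [integral_unitCell_eq_prod, Measure.volume_eq_prod, setIntegral_prod]
  · simp only [integral_Ico_eq_interval]
  · exact ((hF.comp continuous_mk_plane).continuousOn.integrableOn_compact
      (isCompact_Icc.prod isCompact_Icc)).mono_set
        (Set.prod_mono Set.Ico_subset_Icc_self Set.Ico_subset_Icc_self)

theorem integral_unitCell_swap {F : Plane → V} (hF : Continuous F) :
    ∫ x in unitCell, F x = ∫ b in (0 : ℝ)..1, ∫ a in (0 : ℝ)..1, F !₂[a, b] := by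
  rw [integral_unitCell_eq_prod, Measure.volume_eq_prod, ← setIntegral_prod_swap, setIntegral_prod]
  · simp only [integral_Ico_eq_interval, Prod.fst_swap, Prod.snd_swap]
  · exact ((hF.comp (continuous_mk_plane.comp continuous_swap)).continuousOn.integrableOn_compact
      (isCompact_Icc.prod isCompact_Icc)).mono_set
        (Set.prod_mono Set.Ico_subset_Icc_self Set.Ico_subset_Icc_self)

/-- The integral of a partial derivative of a periodic function vanishes. -/
theorem integral_unitCell_pd [CompleteSpace V] {G : Plane → V} (hG : ContDiff ℝ 1 G)
    (hper : IsPeriodic G) (i : Fin 2) : ∫ x in unitCell, pd i G x = 0 := by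
  have hd : Differentiable ℝ G := hG.differentiable (by norm_num)
  have key : ∀ x : Plane, ∫ r in (0 : ℝ)..1, pd i G (x + r • EuclideanSpace.single i (1 : ℝ)) = 0 := by
    intro x
    have hc : Continuous fun r : ℝ => pd i G (x + r • EuclideanSpace.single i (1 : ℝ)) :=
      (continuous_pd hG i).comp (by fun_prop)
    rw [intervalIntegral.integral_eq_sub_of_hasDerivAt
      (f := fun r : ℝ => G (x + r • EuclideanSpace.single i (1 : ℝ)))
      (fun r _ => hasDerivAt_line hd x i r) (hc.intervalIntegrable _ _)]
    refine sub_eq_zero.2 (hper fun j => ?_)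
    by_cases hj : j = i
    · exact ⟨1, by simp [hj]⟩
    · exact ⟨0, by simp [hj]⟩
  fin_cases i
  · rw [integral_unitCell_swap (continuous_pd hG _)]
    have : ∀ a b : ℝ, (!₂[a, b] : Plane) = !₂[0, b] + a • EuclideanSpace.single 0 (1 : ℝ) := by
      intro a b; ext j; fin_cases j <;> simp
    have h : ∀ b : ℝ, ∫ a in (0 : ℝ)..1, pd 0 G !₂[a, b] = 0 := fun b => by
      rw [← key !₂[0, b]]
      exact intervalIntegral.integral_congr fun a _ => congrArg (pd 0 G) (this a b)
    exact (intervalIntegral.integral_congr fun b _ => h b).trans intervalIntegral.integral_zero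
  · rw [integral_unitCell (continuous_pd hG _)]
    have : ∀ a b : ℝ, (!₂[a, b] : Plane) = !₂[a, 0] + b • EuclideanSpace.single 1 (1 : ℝ) := by
      intro a b; ext j; fin_cases j <;> simp
    have h : ∀ a : ℝ, ∫ b in (0 : ℝ)..1, pd 1 G !₂[a, b] = 0 := fun a => by
      rw [← key !₂[a, 0]]
      exact intervalIntegral.integral_congr fun b _ => congrArg (pd 1 G) (this a b)
    exact (intervalIntegral.integral_congr fun b _ => h b).trans intervalIntegral.integral_zero

/-- Green's identity on the torus. -/
theorem integral_unitCell_inner_pd {F G : Plane → Plane} (hF : ContDiff ℝ 1 F)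
    (hG : ContDiff ℝ 2 G) (hFper : IsPeriodic F) (hGper : IsPeriodic G) :
    ∫ x in unitCell, ∑ i, inner ℝ (pd i F x) (pd i G x)
      = - ∫ x in unitCell, inner ℝ (F x) ((Δ G) x) := by
  have h0 : ∀ i, ∫ x in unitCell, (inner ℝ (pd i F x) (pd i G x)
      + inner ℝ (F x) (pd i (pd i G) x)) = 0 := by
    intro i
    have hc : ContDiff ℝ 1 fun x => inner ℝ (F x) (pd i G x) := hF.inner ℝ (contDiff_pd hG i)
    have := integral_unitCell_pd hc (fun x y hxy => by
      simp only [hFper hxy, hGper.pd i hxy]) i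
    rwa [pd_inner (hF.differentiable (by norm_num)) (differentiable_pd hG i)] at this
  have i1 : ∀ i, IntegrableOn (fun x => inner ℝ (pd i F x) (pd i G x)) unitCell := fun i =>
    integrableOn_unitCell ((continuous_pd hF i).inner (contDiff_pd hG i).continuous)
  have i2 : ∀ i, IntegrableOn (fun x => inner ℝ (F x) (pd i (pd i G) x)) unitCell := fun i =>
    integrableOn_unitCell (hF.continuous.inner (continuous_pd_pd hG i))
  simp only [laplacian_eq_sum_pd hG, inner_sum]
  rw [integral_finsetSum _ fun i _ => i1 i, integral_finsetSum _ fun i _ => i2 i,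
    ← Finset.sum_neg_distrib]
  refine Finset.sum_congr rfl fun i _ => ?_
  have := h0 i
  rw [integral_add (i1 i) (i2 i)] at this
  linarith

end UnitCell

/-! ### One-dimensional integrals -/

section OneDim

open Real

/-- `sin²(π y)`, which vanishes exactly on `ℤ`. -/
def sinSq (y : ℝ) : ℝ := sin (π * y) ^ 2

theorem sinSq_nonneg (y : ℝ) : 0 ≤ sinSq y := sq_nonneg _

theorem sinSq_le_one (y : ℝ) : sinSq y ≤ 1 := sin_sq_le_one _

theorem sinSq_add_int (y : ℝ) (n : ℤ) : sinSq (y + n) = sinSq y := by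
  unfold sinSq
  rw [mul_add, mul_comm π (n : ℝ), sin_add_int_mul_pi, mul_pow]
  rcases Int.even_or_odd n with h | h
  · simp [h.neg_one_zpow]
  · simp [h.neg_one_zpow]

theorem continuous_sinSq : Continuous sinSq := by unfold sinSq; fun_prop

/-- Jordan's inequality `sin z ≥ 2z/π` on `[0, π/2]`. -/
theorem four_mul_sq_le_sinSq {y : ℝ} (h : |y| ≤ 1 / 2) : 4 * y ^ 2 ≤ sinSq y := by
  have h1 : 2 * |y| ≤ sin (π * |y|) := by
    have := mul_le_sin (x := π * |y|) (by positivity) (by nlinarith [pi_pos])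
    calc 2 * |y| = 2 / π * (π * |y|) := by field_simp
      _ ≤ _ := this
  have h2 : sinSq y = sin (π * |y|) ^ 2 := by
    unfold sinSq
    rcases abs_cases y with ⟨h, _⟩ | ⟨h, _⟩ <;> rw [h]
    rw [mul_neg, sin_neg, neg_sq]
  rw [h2]
  calc 4 * y ^ 2 = (2 * |y|) ^ 2 := by rw [mul_pow, sq_abs]; norm_num
    _ ≤ _ := pow_le_pow_left₀ (by positivity) h1 2

theorem integral_sinSq_shift {f : ℝ → ℝ} (a : ℝ) :
    ∫ y in (0 : ℝ)..1, f (sinSq (y - a)) = ∫ y in (-(1 / 2) : ℝ)..(1 / 2), f (sinSq y) := by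
  have hp : Function.Periodic (fun y => f (sinSq y)) 1 := fun y => by
    simp only
    rw [show y + 1 = y + ((1 : ℤ) : ℝ) by simp, sinSq_add_int]
  rw [intervalIntegral.integral_comp_sub_right (fun y => f (sinSq y)) a]
  have := hp.intervalIntegral_add_eq (0 - a) (-(1 / 2))
  rw [show (1 : ℝ) - a = 0 - a + 1 by ring, this]
  norm_num

/-- Centre the period at `a` and replace `sinSq y` by `4y²`: the primitive becomes an arctangent,
whose total variation is at most `π`. -/
theorem integral_inv_add_sinSq_le {A σ : ℝ} (hA : 0 < A) (hσ : 0 < σ) (a : ℝ) :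
    ∫ y in (0 : ℝ)..1, (A + σ * sinSq (y - a))⁻¹ ≤ π / (2 * √σ) * (√A)⁻¹ := by
  rw [integral_sinSq_shift (f := fun z => (A + σ * z)⁻¹)]
  set c := 2 * (√σ / √A) with hc
  have hsA : 0 < √A := sqrt_pos.2 hA
  have hsσ : 0 < √σ := sqrt_pos.2 hσ
  have hc0 : 0 < c := by positivity
  have hpt : ∀ y ∈ Set.Icc (-(1 / 2) : ℝ) (1 / 2),
      (A + σ * sinSq y)⁻¹ ≤ A⁻¹ * (1 + (c * y) ^ 2)⁻¹ := by
    intro y hy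
    rw [← mul_inv]
    have h := four_mul_sq_le_sinSq (abs_le.2 hy)
    have e : A * (1 + (c * y) ^ 2) = A + σ * (4 * y ^ 2) := by
      rw [hc, mul_pow, mul_pow, div_pow, sq_sqrt hσ.le, sq_sqrt hA.le]
      field_simp; ring
    rw [e]
    exact inv_anti₀ (by positivity) (by gcongr)
  have hcs := continuous_sinSq
  calc _ ≤ ∫ y in (-(1 / 2) : ℝ)..(1 / 2), A⁻¹ * (1 + (c * y) ^ 2)⁻¹ := by
        refine intervalIntegral.integral_mono_on (by norm_num) ?_ ?_ hpt
        · refine Continuous.intervalIntegrable ?_ _ _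
          exact Continuous.inv₀ (by fun_prop) fun y =>
            (by have := sinSq_nonneg y; positivity)
        · refine Continuous.intervalIntegrable ?_ _ _
          exact continuous_const.mul (Continuous.inv₀ (by fun_prop) fun y => by positivity)
    _ = A⁻¹ * (c⁻¹ * (arctan (c * (1 / 2)) - arctan (c * -(1 / 2)))) := by
        rw [intervalIntegral.integral_const_mul,
          intervalIntegral.integral_comp_mul_left (fun y => (1 + y ^ 2)⁻¹) hc0.ne',
          integral_inv_one_add_sq, smul_eq_mul]
    _ ≤ A⁻¹ * (c⁻¹ * π) := by
        have h1 := arctan_lt_pi_div_two (c * (1 / 2))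
        have h2 := neg_pi_div_two_lt_arctan (c * -(1 / 2))
        gcongr
        linarith
    _ = _ := by
        rw [hc]
        nth_rw 1 [← sq_sqrt hA.le]
        field_simp

/-- This is the outer integral of the two-dimensional estimate, and the source of its logarithm: the
integrand is comparable to `1/(1 + 2√σ y)` on half a period. -/
theorem integral_inv_sqrt_sinSq_le {σ : ℝ} (hσ : 0 < σ) (a : ℝ) :
    ∫ y in (0 : ℝ)..1, (√(1 + σ * sinSq (y - a)))⁻¹ ≤ 2 / √σ * log (1 + √σ) := by
  rw [integral_sinSq_shift (f := fun z => (√(1 + σ * z))⁻¹)]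
  have hsσ : 0 < √σ := sqrt_pos.2 hσ
  have hcs := continuous_sinSq
  have hpos : ∀ y, 0 < 1 + σ * sinSq y := fun y => by have := sinSq_nonneg y; positivity
  have hint : ∀ x y : ℝ, IntervalIntegrable (fun y => (√(1 + σ * sinSq y))⁻¹)
      MeasureTheory.volume x y := fun x y =>
    (Continuous.inv₀ (by fun_prop) fun y => (sqrt_pos.2 (hpos y)).ne').intervalIntegrable _ _
  have heven : ∫ y in (-(1 / 2) : ℝ)..0, (√(1 + σ * sinSq y))⁻¹
      = ∫ y in (0 : ℝ)..(1 / 2), (√(1 + σ * sinSq y))⁻¹ := by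
    have h := intervalIntegral.integral_comp_neg (a := 0) (b := 1 / 2)
      (fun y => (√(1 + σ * sinSq y))⁻¹)
    have e : ∀ y, sinSq (-y) = sinSq y := fun y => by simp [sinSq]
    simp only [e, neg_zero] at h
    exact h.symm
  rw [← intervalIntegral.integral_add_adjacent_intervals (hint _ 0) (hint 0 _), heven, ← two_mul]
  have hpt : ∀ y ∈ Set.Icc (0 : ℝ) (1 / 2),
      (√(1 + σ * sinSq y))⁻¹ ≤ 2 * (1 + 2 * √σ * y)⁻¹ := by
    intro y hy
    have h := four_mul_sq_le_sinSq (y := y) (by rw [abs_of_nonneg hy.1]; exact hy.2)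
    have hy0 := hy.1
    -- With `s = 2√σ y`, this is `(1 + s)² ≤ 4(1 + s²)`.
    have h1 : (1 + 2 * √σ * y) / 2 ≤ √(1 + σ * sinSq y) := by
      refine le_sqrt_of_sq_le ?_
      have h2 : σ * (4 * y ^ 2) ≤ σ * sinSq y := by gcongr
      have h3 : (2 * √σ * y) ^ 2 = σ * (4 * y ^ 2) := by
        rw [mul_pow, mul_pow, sq_sqrt hσ.le]; ring
      nlinarith [sq_nonneg (2 * √σ * y - 1)]
    calc (√(1 + σ * sinSq y))⁻¹ ≤ ((1 + 2 * √σ * y) / 2)⁻¹ := inv_anti₀ (by positivity) h1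
      _ = _ := by rw [inv_div, div_eq_mul_inv]
  have hder : ∀ y ∈ Set.uIcc (0 : ℝ) (1 / 2),
      HasDerivAt (fun y => (√σ)⁻¹ * log (1 + 2 * √σ * y)) (2 * (1 + 2 * √σ * y)⁻¹) y := by
    intro y hy
    rw [Set.uIcc_of_le (by norm_num)] at hy
    have hy0 := hy.1
    have h1 : HasDerivAt (fun y => 1 + 2 * √σ * y) (2 * √σ) y := by
      simpa using ((hasDerivAt_id y).const_mul (2 * √σ)).const_add 1
    refine ((h1.log (by positivity)).const_mul (√σ)⁻¹).congr_deriv ?_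
    field_simp
  have hintR : IntervalIntegrable (fun y => 2 * (1 + 2 * √σ * y)⁻¹) MeasureTheory.volume 0 (1 / 2) := by
    refine ContinuousOn.intervalIntegrable ?_
    refine continuousOn_const.mul (ContinuousOn.inv₀ (by fun_prop) fun y hy => ?_)
    rw [Set.uIcc_of_le (by norm_num)] at hy
    have hy0 := hy.1
    positivity
  have hmono := intervalIntegral.integral_mono_on (by norm_num) (hint 0 (1 / 2)) hintR hpt
  rw [intervalIntegral.integral_eq_sub_of_hasDerivAt hder hintR] at hmono
  have e : (√σ)⁻¹ * log (1 + 2 * √σ * (1 / 2)) - (√σ)⁻¹ * log (1 + 2 * √σ * 0)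
      = (√σ)⁻¹ * log (1 + √σ) := by
    simp; left; ring_nf
  rw [e] at hmono
  calc _ ≤ 2 * ((√σ)⁻¹ * log (1 + √σ)) := by linarith
    _ = _ := by ring

end OneDim

/-! ### The squared chordal distance on the torus -/

/-- The squared chordal distance `∑ᵢ sin² (π (xᵢ - aᵢ))` of two points of the torus. -/
def chordSq (a x : Plane) : ℝ := ∑ i, sinSq (x i - a i)

theorem chordSq_nonneg (a x : Plane) : 0 ≤ chordSq a x :=
  Finset.sum_nonneg fun _ _ => sinSq_nonneg _

theorem chordSq_le_two (a x : Plane) : chordSq a x ≤ 2 := by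
  rw [chordSq, Fin.sum_univ_two]
  linarith [sinSq_le_one (x 0 - a 0), sinSq_le_one (x 1 - a 1)]

theorem contDiff_chordSq (a : Plane) : ContDiff ℝ 2 (chordSq a) := by
  unfold chordSq sinSq
  fun_prop

theorem isPeriodic_chordSq (a : Plane) : IsPeriodic (chordSq a) := by
  intro x y h
  refine Finset.sum_congr rfl fun i _ => ?_
  obtain ⟨n, hn⟩ := h i
  rw [hn, add_sub_right_comm, sinSq_add_int]

theorem chordSq_fractPart (a x : Plane) : chordSq (fractPart a) x = chordSq a x := by
  refine Finset.sum_congr rfl fun i _ => ?_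
  have : x i - fractPart a i = x i - a i + ⌊a i⌋ := by
    change x i - Int.fract (a i) = _
    rw [← Int.self_sub_floor]; ring
  rw [this, sinSq_add_int]

theorem chordSq_le_norm_sq (a x : Plane) : chordSq a x ≤ Real.pi ^ 2 * ‖x - a‖ ^ 2 := by
  rw [EuclideanSpace.norm_sq_eq, Finset.mul_sum]
  refine Finset.sum_le_sum fun i _ => ?_
  unfold sinSq
  rw [← mul_pow, ← sq_abs (Real.sin _)]
  refine pow_le_pow_left₀ (abs_nonneg _) ?_ 2
  refine Real.abs_sin_le_abs.trans (le_of_eq ?_)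
  rw [abs_mul, abs_of_pos Real.pi_pos]
  rfl

/-- A quasi-triangle inequality, from `sin²(α - β) ≤ 2 sin²α + 2 sin²β` in each coordinate. -/
theorem chordSq_le_add (a b x : Plane) : chordSq a b ≤ 2 * (chordSq a x + chordSq b x) := by
  unfold chordSq
  rw [← Finset.sum_add_distrib, Finset.mul_sum]
  refine Finset.sum_le_sum fun i _ => ?_
  unfold sinSq
  have e : Real.pi * (b i - a i) = Real.pi * (x i - a i) - Real.pi * (x i - b i) := by ring
  rw [e, Real.sin_sub]
  set α := Real.pi * (x i - a i)
  set β := Real.pi * (x i - b i)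
  have h1 := Real.cos_sq_le_one α
  have h2 := Real.cos_sq_le_one β
  nlinarith [sq_nonneg (Real.sin α * Real.cos β + Real.cos α * Real.sin β),
    mul_nonneg (sq_nonneg (Real.sin α)) (sub_nonneg.2 h2),
    mul_nonneg (sq_nonneg (Real.sin β)) (sub_nonneg.2 h1)]

theorem chordSq_pos {a b : Plane} (ha : a ∈ unitCell) (hb : b ∈ unitCell) (hab : a ≠ b) :
    0 < chordSq a b := by
  refine lt_of_le_of_ne (chordSq_nonneg a b) fun h => hab ?_
  have h0 := (Finset.sum_eq_zero_iff_of_nonneg fun i _ => sinSq_nonneg (b i - a i)).1 h.symm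
  ext i
  have h1 : Real.sin (Real.pi * (b i - a i)) = 0 := pow_eq_zero_iff (two_ne_zero) |>.1 (h0 i (Finset.mem_univ _))
  obtain ⟨n, hn⟩ := Real.sin_eq_zero_iff.1 h1
  have h2 : (n : ℝ) = b i - a i := by
    have := Real.pi_pos.ne'
    apply mul_right_cancel₀ this; linarith
  have h3 : (n : ℝ) < 1 := by rw [h2]; linarith [(ha i).1, (hb i).2]
  have h4 : (-1 : ℝ) < n := by rw [h2]; linarith [(ha i).2, (hb i).1]
  have h5 : n = 0 := by
    have h3' : n < 1 := by exact_mod_cast h3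
    have h4' : -1 < n := by exact_mod_cast h4
    omega
  rw [h5] at h2
  simp at h2
  linarith

open Real in
-- The kernel decays like `r⁻²`, which is borderline in two dimensions. Fubini reduces it to an
-- arctangent integral followed by a logarithmic one.
theorem integral_inv_chordSq_le {σ : ℝ} (hσ : 0 < σ) (a : Plane) :
    ∫ x in unitCell, (1 + σ * chordSq a x)⁻¹ ≤ π / σ * log (1 + √σ) := by
  have hpos : ∀ x, 0 < 1 + σ * chordSq a x := fun x => by
    have := chordSq_nonneg a x; positivity
  have hc : Continuous fun x => (1 + σ * chordSq a x)⁻¹ :=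
    Continuous.inv₀ (continuous_const.add (continuous_const.mul (contDiff_chordSq a).continuous))
      fun x => (hpos x).ne'
  have hcs := continuous_sinSq
  rw [integral_unitCell hc]
  have hin : ∀ x : ℝ, ∫ y in (0 : ℝ)..1, (1 + σ * chordSq a !₂[x, y])⁻¹
      ≤ π / (2 * √σ) * (√(1 + σ * sinSq (x - a 0)))⁻¹ := by
    intro x
    have hA : 0 < 1 + σ * sinSq (x - a 0) := by have := sinSq_nonneg (x - a 0); positivity
    refine (le_of_eq ?_).trans (integral_inv_add_sinSq_le hA hσ (a 1))
    congr 1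
    ext y
    simp only [chordSq, Fin.sum_univ_two]
    simp
    ring
  have hsp : ∀ x, 0 < √(1 + σ * sinSq (x - a 0)) := fun x => by
    have := sinSq_nonneg (x - a 0); positivity
  calc _ ≤ ∫ x in (0 : ℝ)..1, π / (2 * √σ) * (√(1 + σ * sinSq (x - a 0)))⁻¹ := by
        refine intervalIntegral.integral_mono_on zero_le_one ?_ ?_ fun x _ => hin x
        · refine Continuous.intervalIntegrable ?_ _ _
          exact intervalIntegral.continuous_parametric_intervalIntegral_of_continuous'
            (f := fun x y => (1 + σ * chordSq a !₂[x, y])⁻¹)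
            (hc.comp continuous_mk_plane) _ _
        · exact (continuous_const.mul (Continuous.inv₀ (by fun_prop)
            fun x => (hsp x).ne')).intervalIntegrable _ _
    _ ≤ π / (2 * √σ) * (2 / √σ * log (1 + √σ)) := by
        rw [intervalIntegral.integral_const_mul]
        exact mul_le_mul_of_nonneg_left (integral_inv_sqrt_sinSq_le hσ _) (by positivity)
    _ = _ := by
        have h := sq_sqrt hσ.le
        have h' : 0 < √σ := sqrt_pos.2 hσ
        nth_rw 4 [← h]
        field_simp

open Real in
-- The kernel decays like `r⁻⁴`, so no logarithm appears. The bound `(1 + p + q)² ≥ (1 + p)(1 + q)`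
-- separates the variables.
theorem integral_inv_chordSq_sq_le {σ : ℝ} (hσ : 0 < σ) (a : Plane) :
    ∫ x in unitCell, ((1 + σ * chordSq a x)⁻¹) ^ 2 ≤ π ^ 2 / (4 * σ) := by
  have hpos : ∀ x, 0 < 1 + σ * chordSq a x := fun x => by
    have := chordSq_nonneg a x; positivity
  have hc : Continuous fun x => ((1 + σ * chordSq a x)⁻¹) ^ 2 :=
    (Continuous.inv₀ (continuous_const.add (continuous_const.mul (contDiff_chordSq a).continuous))
      fun x => (hpos x).ne').pow 2
  have hcs := continuous_sinSq
  have h1 : ∀ y b : ℝ, 0 < 1 + σ * sinSq (y - b) := fun y b => by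
    have := sinSq_nonneg (y - b); positivity
  have hcc : ∀ b, Continuous fun y : ℝ => (1 + σ * sinSq (y - b))⁻¹ := fun b =>
    Continuous.inv₀ (by fun_prop) fun y => (h1 y b).ne'
  have hJ : ∀ b, ∫ y in (0 : ℝ)..1, (1 + σ * sinSq (y - b))⁻¹ ≤ π / (2 * √σ) := fun b => by
    simpa using integral_inv_add_sinSq_le one_pos hσ b
  rw [integral_unitCell hc]
  have hin : ∀ x : ℝ, ∫ y in (0 : ℝ)..1, ((1 + σ * chordSq a !₂[x, y])⁻¹) ^ 2
      ≤ (1 + σ * sinSq (x - a 0))⁻¹ * (π / (2 * √σ)) := by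
    intro x
    calc _ ≤ ∫ y in (0 : ℝ)..1, (1 + σ * sinSq (x - a 0))⁻¹ * (1 + σ * sinSq (y - a 1))⁻¹ := by
          refine intervalIntegral.integral_mono_on zero_le_one ?_ ?_ fun y _ => ?_
          · refine Continuous.intervalIntegrable ?_ _ _
            exact hc.comp (continuous_mk_plane.comp (Continuous.prodMk_right x))
          · exact (continuous_const.mul (hcc _)).intervalIntegrable _ _
          · rw [← mul_inv, inv_pow]
            refine inv_anti₀ (mul_pos (h1 _ _) (h1 _ _)) ?_
            simp only [chordSq, Fin.sum_univ_two]
            simp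
            have p := sinSq_nonneg (x - a 0)
            have q := sinSq_nonneg (y - a 1)
            have hp : 0 ≤ σ * sinSq (x - a 0) := by positivity
            have hq : 0 ≤ σ * sinSq (y - a 1) := by positivity
            nlinarith [mul_nonneg hp hq]
      _ ≤ _ := by
          rw [intervalIntegral.integral_const_mul]
          exact mul_le_mul_of_nonneg_left (hJ _) (inv_nonneg.2 (h1 _ _).le)
  calc _ ≤ ∫ x in (0 : ℝ)..1, (1 + σ * sinSq (x - a 0))⁻¹ * (π / (2 * √σ)) := by
        refine intervalIntegral.integral_mono_on zero_le_one ?_ ?_ fun x _ => hin x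
        · refine Continuous.intervalIntegrable ?_ _ _
          exact intervalIntegral.continuous_parametric_intervalIntegral_of_continuous'
            (f := fun x y => ((1 + σ * chordSq a !₂[x, y])⁻¹) ^ 2)
            (hc.comp continuous_mk_plane) _ _
        · exact ((hcc _).mul continuous_const).intervalIntegrable _ _
    _ ≤ π / (2 * √σ) * (π / (2 * √σ)) := by
        rw [intervalIntegral.integral_mul_const]
        exact mul_le_mul_of_nonneg_right (hJ _) (by positivity)
    _ = _ := by
        have h := sq_sqrt hσ.le
        nth_rw 3 [← h]
        field_simp; ring

theorem exists_pos_le_of_finset {ι : Type*} (t : Finset ι) (c : ι → ℝ) (hc : ∀ i ∈ t, 0 < c i) :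
    ∃ η, 0 < η ∧ η ≤ 1 ∧ ∀ i ∈ t, η ≤ c i := by
  classical
  induction t using Finset.induction_on with
  | empty => exact ⟨1, one_pos, le_rfl, by simp⟩
  | insert a s _ ih =>
    obtain ⟨η, h0, h1, h⟩ := ih fun i hi => hc i (Finset.mem_insert_of_mem hi)
    refine ⟨min η (c a), lt_min h0 (hc a (Finset.mem_insert_self _ _)),
      (min_le_left _ _).trans h1, fun i hi => ?_⟩
    rcases Finset.mem_insert.1 hi with rfl | hi
    · exact min_le_right _ _
    · exact (min_le_left _ _).trans (h i hi)

/-! ### Nonnegative functions with bounded second derivatives -/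

/-- Taylor's bound `0 ≤ f(r) ≤ f(0) + f'(0)r + Mr²/2` holds for all `r`, so the quadratic has
nonpositive discriminant. Convexity of `ψ`, the quadratic minus `f`, gives the upper bound. -/
theorem deriv_sq_le_of_nonneg {f f' f'' : ℝ → ℝ} {M : ℝ} (hM : 0 < M)
    (hf : ∀ r, HasDerivAt f (f' r) r) (hf' : ∀ r, HasDerivAt f' (f'' r) r)
    (hbd : ∀ r, f'' r ≤ M) (hnn : ∀ r, 0 ≤ f r) : f' 0 ^ 2 ≤ 2 * M * f 0 := by
  set ψ : ℝ → ℝ := fun r => M / 2 * r ^ 2 + f' 0 * r + f 0 - f r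
  set ψ' : ℝ → ℝ := fun r => M * r + f' 0 - f' r
  have h1 : ∀ r, HasDerivAt ψ (ψ' r) r := fun r => by
    have := ((((hasDerivAt_pow 2 r).const_mul (M / 2)).add
      ((hasDerivAt_id r).const_mul (f' 0))).add_const (f 0)).sub (hf r)
    exact this.congr_deriv (by simp [ψ']; ring)
  have h2 : ∀ r, HasDerivAt ψ' (M - f'' r) r := fun r => by
    have := (((hasDerivAt_id r).const_mul M).add_const (f' 0)).sub (hf' r)
    exact this.congr_deriv (by simp)
  have hmono : Monotone ψ' := monotone_of_deriv_nonneg (fun r => (h2 r).differentiableAt)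
    fun r => by rw [(h2 r).deriv]; linarith [hbd r]
  have hd : deriv ψ = ψ' := funext fun r => (h1 r).deriv
  have hconv : ConvexOn ℝ Set.univ ψ := by
    refine MonotoneOn.convexOn_of_deriv convex_univ ?_ ?_ ?_
    · exact fun r _ => (h1 r).continuousAt.continuousWithinAt
    · exact fun r _ => (h1 r).differentiableAt.differentiableWithinAt
    · rw [hd]; exact hmono.monotoneOn _
  have hψ0 : ψ' 0 = 0 := by simp [ψ']
  have hpos : ∀ r, 0 ≤ ψ r := fun r => by
    have e : ψ 0 = 0 := by simp [ψ]
    rcases lt_trichotomy r 0 with h | h | h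
    · have := hconv.slope_le_of_hasDerivAt (Set.mem_univ r) (Set.mem_univ 0) h (h1 0)
      rw [slope_def_field, hψ0, e] at this
      by_contra! hn
      have : 0 < (0 - ψ r) / (0 - r) := div_pos (by linarith) (by linarith)
      linarith
    · rw [h, e]
    · have := hconv.le_slope_of_hasDerivAt (Set.mem_univ 0) (Set.mem_univ r) h (h1 0)
      rw [slope_def_field, hψ0, e] at this
      by_contra! hn
      have : (ψ r - 0) / (r - 0) < 0 := div_neg_of_neg_of_pos (by linarith) (by linarith)
      linarith
  -- The minimiser of the quadratic.
  have h3 := hpos (-(f' 0 / M))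
  have h4 := hnn (-(f' 0 / M))
  have h5 : 0 ≤ M / 2 * (-(f' 0 / M)) ^ 2 + f' 0 * (-(f' 0 / M)) + f 0 := by
    simp only [ψ] at h3; linarith
  have h6 : M / 2 * (-(f' 0 / M)) ^ 2 + f' 0 * (-(f' 0 / M)) + f 0
    = (2 * M * f 0 - f' 0 ^ 2) / (2 * M) := by field_simp; ring
  rw [h6] at h5
  have := (div_nonneg_iff.1 h5)
  rcases this with h | h
  · linarith [h.1]
  · linarith [h.2]

theorem exists_pd_bounds {d : Plane → ℝ} (hd : ContDiff ℝ 2 d) (hper : IsPeriodic d)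
    (hd0 : ∀ x, 0 ≤ d x) :
    ∃ M, 0 < M ∧ (∀ i x, (pd i d x) ^ 2 ≤ M * d x) ∧ ∀ x, |(Δ d) x| ≤ M := by
  have hb : ∀ i, ∃ C, 0 < C ∧ ∀ x, |pd i (pd i d) x| ≤ C := fun i =>
    ((hper.pd i).pd i).exists_bound (continuous_pd_pd hd i)
  choose C hC0 hC using hb
  have h2 : ∀ i x, (pd i d x) ^ 2 ≤ 2 * C i * d x := fun i x => by
    have := deriv_sq_le_of_nonneg (hC0 i)
      (hasDerivAt_line (differentiable_of_contDiff_two hd) x i)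
      (hasDerivAt_line (differentiable_pd hd i) x i) (fun r => (abs_le.1 (hC i _)).2)
      (fun r => hd0 _)
    simpa using this
  refine ⟨2 * C 0 + 2 * C 1, by linarith [hC0 0, hC0 1], fun i x => (h2 i x).trans ?_, fun x => ?_⟩
  · refine mul_le_mul_of_nonneg_right ?_ (hd0 x)
    fin_cases i
    · simpa using (hC0 1).le
    · simpa using (hC0 0).le
  · rw [laplacian_eq_sum_pd hd, Fin.sum_univ_two]
    refine (abs_add_le _ _).trans ?_
    linarith [hC 0 x, hC 1 x, hC0 0, hC0 1]

/-! ### The smooth minorant of the initial modulus -/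

/-- At a zero the invertible derivative gives `|x - b| ≤ C|f(x)|` nearby; elsewhere `|f|²` is
locally bounded below while `chordSq` is bounded above. -/
theorem eventually_mul_chordSq_le {f : Plane → Plane} (hf : ContDiff ℝ 1 f) (b : Plane)
    (hdet : f b = 0 → (fderiv ℝ f b).det ≠ 0) :
    ∃ c, 0 < c ∧ ∀ᶠ x in nhds b, c * chordSq b x ≤ ‖f x‖ ^ 2 := by
  by_cases hb : f b = 0
  · set e := (fderiv ℝ f b).toContinuousLinearEquivOfDetNeZero (hdet hb)
    have hfd : HasFDerivAt f (fderiv ℝ f b) b :=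
      (hf.differentiable (by norm_num) b).hasFDerivAt
    have h1 : (fun x => x - b) =O[nhds b] fun x => f x - f b := by
      exact (hfd.isTheta_sub e.toHomeomorph.isInducing).isBigO_symm
    obtain ⟨C, hC0, hC⟩ := h1.exists_pos
    refine ⟨(Real.pi ^ 2 * C ^ 2)⁻¹, by have := Real.pi_pos; positivity, ?_⟩
    filter_upwards [hC.bound] with x hx
    rw [hb, sub_zero] at hx
    rw [inv_mul_le_iff₀ (by have := Real.pi_pos; positivity)]
    calc chordSq b x ≤ Real.pi ^ 2 * ‖x - b‖ ^ 2 := chordSq_le_norm_sq b x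
      _ ≤ Real.pi ^ 2 * (C * ‖f x‖) ^ 2 := by gcongr
      _ = _ := by ring
  · have hpos : 0 < ‖f b‖ ^ 2 := by positivity
    refine ⟨‖f b‖ ^ 2 / 4, by positivity, ?_⟩
    have hc : Continuous fun x => ‖f x‖ ^ 2 := hf.continuous.norm.pow 2
    filter_upwards [hc.continuousAt.eventually (lt_mem_nhds (half_lt_self hpos))] with x hx
    nlinarith [chordSq_le_two b x, chordSq_nonneg b x]

/-- Compactness of the cell. The finite set may contain points where `f` does not vanish; they only
increase the number of terms summed later. Reducing to the half-open cell makes distinct points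
distinct on the torus. -/
theorem exists_chordSq_minorant {f : Plane → Plane} (hf : ContDiff ℝ 1 f) (hper : IsPeriodic f)
    (hdet : ∀ x, f x = 0 → (fderiv ℝ f x).det ≠ 0) :
    ∃ (T : Finset Plane) (η : ℝ), ↑T ⊆ unitCell ∧ T.Nonempty ∧ 0 < η ∧
      ∀ x, ∃ a ∈ T, η * chordSq a x ≤ ‖f x‖ ^ 2 := by
  classical
  choose c hc0 hc using fun b => eventually_mul_chordSq_le hf b (hdet b)
  obtain ⟨t, -, ht⟩ := isCompact_closedCell.elim_nhds_subcover
    (fun b => {x | c b * chordSq b x ≤ ‖f x‖ ^ 2}) fun b _ => hc b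
  obtain ⟨η, hη0, -, hη⟩ := exists_pos_le_of_finset t c fun b _ => hc0 b
  have key : ∀ x, ∃ a ∈ t.image fractPart, η * chordSq a x ≤ ‖f x‖ ^ 2 := fun x => by
    obtain ⟨b, hb, hx⟩ := Set.mem_iUnion₂.1 (ht (fractPart_mem_closedCell x))
    refine ⟨fractPart b, Finset.mem_image_of_mem _ hb, ?_⟩
    have hx' : c b * chordSq b (fractPart x) ≤ ‖f (fractPart x)‖ ^ 2 := hx
    rw [hper.fractPart_eq, (isPeriodic_chordSq b).fractPart_eq] at hx'
    rw [chordSq_fractPart]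
    exact (mul_le_mul_of_nonneg_right (hη b hb) (chordSq_nonneg b x)).trans hx'
  refine ⟨t.image fractPart, η, ?_, ?_, hη0, key⟩
  · intro a ha
    obtain ⟨b, -, rfl⟩ := Finset.mem_image.1 (Finset.mem_coe.1 ha)
    exact fractPart_mem_unitCell b
  · obtain ⟨a, ha, -⟩ := key 0
    exact ⟨a, ha⟩

/-- The product of the squared chordal distances to finitely many points of the torus is
comparable to their minimum. -/
theorem exists_mul_chordSq_le_prod {T : Finset Plane} (hT : ↑T ⊆ unitCell) (hne : T.Nonempty) :
    ∃ c, 0 < c ∧ ∀ x, ∃ a ∈ T, c * chordSq a x ≤ ∏ b ∈ T, (chordSq b x / 2) := by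
  classical
  -- If `a` is nearest to `x`, then `chordSq b a ≤ 2(chordSq b x + chordSq a x) ≤ 4 chordSq b x`;
  -- the halving in the product turns 4 into 8.
  obtain ⟨δ, hδ0, -, hδ⟩ := exists_pos_le_of_finset T.offDiag
    (fun p => chordSq p.1 p.2 / 8) fun p hp => by
      obtain ⟨h1, h2, h3⟩ := Finset.mem_offDiag.1 hp
      exact div_pos (chordSq_pos (hT h1) (hT h2) h3) (by norm_num)
  refine ⟨δ ^ (T.card - 1) / 2, by positivity, fun x => ?_⟩
  obtain ⟨a, ha, hmin⟩ := T.exists_min_image (fun b => chordSq b x) hne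
  refine ⟨a, ha, ?_⟩
  rw [← Finset.mul_prod_erase T _ ha]
  have h : ∏ _b ∈ T.erase a, δ ≤ ∏ b ∈ T.erase a, (chordSq b x / 2) := by
    refine Finset.prod_le_prod (fun _ _ => hδ0.le) fun b hb => ?_
    obtain ⟨hba, hbT⟩ := Finset.mem_erase.1 hb
    have h1 := hδ (b, a) (Finset.mem_offDiag.2 ⟨hbT, ha, hba⟩)
    have h2 := chordSq_le_add b a x
    have h3 := hmin b hbT
    simp only at h1
    linarith
  rw [Finset.prod_const, Finset.card_erase_of_mem ha] at h
  calc _ = chordSq a x / 2 * δ ^ (T.card - 1) := by ring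
    _ ≤ _ := mul_le_mul_of_nonneg_left h (by linarith [chordSq_nonneg a x])

/-- The minimum of the `chordSq a` is not smooth, but their product is. After halving, every factor
is at most 1, so the product lies below each factor, while separation of the points keeps it
comparable to the smallest. -/
theorem exists_smooth_minorant {f : Plane → Plane} (hf : ContDiff ℝ 1 f) (hper : IsPeriodic f)
    (hdet : ∀ x, f x = 0 → (fderiv ℝ f x).det ≠ 0) :
    ∃ (d : Plane → ℝ) (T : Finset Plane) (M c : ℝ), 0 < M ∧ 0 < c ∧ T.Nonempty ∧
      ContDiff ℝ 2 d ∧ IsPeriodic d ∧ (∀ x, 0 ≤ d x) ∧ (∀ x, d x ≤ ‖f x‖ ^ 2) ∧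
      (∀ i x, (pd i d x) ^ 2 ≤ M * d x) ∧ (∀ x, |(Δ d) x| ≤ M) ∧
      ∀ x, ∃ a ∈ T, c * chordSq a x ≤ d x := by
  classical
  obtain ⟨T, η, hT, hne, hη, hmin⟩ := exists_chordSq_minorant hf hper hdet
  obtain ⟨c, hc, hprod⟩ := exists_mul_chordSq_le_prod hT hne
  set d : Plane → ℝ := fun x => η * ∏ b ∈ T, (chordSq b x / 2) with hd
  have hdc : ContDiff ℝ 2 d :=
    contDiff_const.mul (contDiff_prod fun b _ => (contDiff_chordSq b).div_const 2)
  have hdper : IsPeriodic d := fun x y hxy => by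
    simp only [hd]
    congr 1
    exact Finset.prod_congr rfl fun b _ => by rw [isPeriodic_chordSq b hxy]
  have hd0 : ∀ x, 0 ≤ d x := fun x => mul_nonneg hη.le
    (Finset.prod_nonneg fun b _ => by linarith [chordSq_nonneg b x])
  obtain ⟨M, hM, hM1, hM2⟩ := exists_pd_bounds hdc hdper hd0
  refine ⟨d, T, M, η * c, hM, by positivity, hne, hdc, hdper, hd0, fun x => ?_, hM1, hM2,
    fun x => ?_⟩
  · obtain ⟨a, ha, hx⟩ := hmin x
    refine le_trans ?_ hx
    simp only [hd]
    refine mul_le_mul_of_nonneg_left ?_ hη.le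
    rw [← Finset.mul_prod_erase T _ ha]
    have h1 : ∏ b ∈ T.erase a, (chordSq b x / 2) ≤ 1 := Finset.prod_le_one
      (fun b _ => by linarith [chordSq_nonneg b x]) fun b _ => by linarith [chordSq_le_two b x]
    have h2 := chordSq_nonneg a x
    nlinarith
  · obtain ⟨a, ha, hx⟩ := hprod x
    refine ⟨a, ha, ?_⟩
    rw [mul_assoc]
    exact mul_le_mul_of_nonneg_left hx hη.le

theorem exists_lipschitz_sq {f : Plane → Plane} (hf : ContDiff ℝ 1 f) (hper : IsPeriodic f) :
    ∃ K, 0 < K ∧ ∀ x y, ‖f y - f x‖ ^ 2 ≤ K * ‖y - x‖ ^ 2 := by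
  obtain ⟨C, hC0, hC⟩ := IsPeriodic.exists_bound (F := fun x => ‖fderiv ℝ f x‖)
    (fun x y hxy => by simp only [hper.fderiv hxy]) (hf.continuous_fderiv (by norm_num)).norm
  refine ⟨C ^ 2, by positivity, fun x y => ?_⟩
  rw [← mul_pow]
  refine pow_le_pow_left₀ (norm_nonneg _) ?_ 2
  exact convex_univ.norm_image_sub_le_of_norm_fderiv_le
    (fun x _ => hf.differentiable (by norm_num) x)
    (fun x _ => by simpa using hC x) (Set.mem_univ _) (Set.mem_univ _)

section

/-! ### Energy dissipation -/

open MeasureTheory Filter Topology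

/-- The free energy of which the heat flow is the gradient flow. -/
def freeEnergy (ε : ℝ) (F : Plane → Plane) : ℝ :=
  ∫ x in unitCell, (gradSq F x / 2 + 1 / (4 * ε ^ 2) * (1 - ‖F x‖ ^ 2) ^ 2)

theorem integrableOn_gradSq {F : Plane → Plane} (hF : ContDiff ℝ 1 F) :
    IntegrableOn (gradSq F) unitCell := integrableOn_unitCell (continuous_gradSq hF)

theorem integrableOn_potential {F : Plane → Plane} (hF : Continuous F) (c : ℝ) :
    IntegrableOn (fun x => c * (1 - ‖F x‖ ^ 2) ^ 2) unitCell :=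
  integrableOn_unitCell (by fun_prop)

theorem energy_le_two_mul_freeEnergy (ε : ℝ) {f : Torus → Plane} (hf : ContDiff ℝ 1 (lift f)) :
    energy ε f ≤ 2 * freeEnergy ε (lift f) := by
  unfold energy freeEnergy
  rw [← integral_const_mul]
  refine integral_mono ((integrableOn_gradSq hf).add (integrableOn_potential hf.continuous _))
    ((((integrableOn_gradSq hf).div_const 2).add
      (integrableOn_potential hf.continuous _)).const_mul 2) fun x => ?_
  have : 0 ≤ 1 / (4 * ε ^ 2) * (1 - ‖lift f x‖ ^ 2) ^ 2 := by positivity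
  simp only
  linarith

theorem freeEnergy_le_energy (ε : ℝ) {f : Torus → Plane} (hf : ContDiff ℝ 1 (lift f)) :
    freeEnergy ε (lift f) ≤ energy ε f := by
  unfold energy freeEnergy
  refine integral_mono (((integrableOn_gradSq hf).div_const 2).add
    (integrableOn_potential hf.continuous _))
    ((integrableOn_gradSq hf).add (integrableOn_potential hf.continuous _)) fun x => ?_
  have := gradSq_nonneg (lift f) x
  simp only
  linarith

/-- Green's identity applied to `|∇F|² - |∇G|² = ∇(F - G)·∇(F + G)`. It lets the Dirichlet energy be
differentiated in time without assuming that `∂ₜ∇u` exists. -/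
theorem integral_gradSq_sub {F G : Plane → Plane} (hF : ContDiff ℝ 2 F) (hG : ContDiff ℝ 2 G)
    (hFper : IsPeriodic F) (hGper : IsPeriodic G) :
    (∫ x in unitCell, gradSq F x) - ∫ x in unitCell, gradSq G x
      = - ∫ x in unitCell, inner ℝ (F x - G x) ((Δ F) x + (Δ G) x) := by
  have hF1 : ContDiff ℝ 1 F := hF.of_le (by norm_num)
  have hG1 : ContDiff ℝ 1 G := hG.of_le (by norm_num)
  have dF := differentiable_of_contDiff_two hF
  have dG := differentiable_of_contDiff_two hG
  have h := integral_unitCell_inner_pd (hF1.sub hG1) (hF.add hG)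
    (fun x y hxy => by simp only [hFper hxy, hGper hxy])
    (fun x y hxy => by simp only [hFper hxy, hGper hxy])
  have e : ∀ x, (Δ (fun x => F x + G x)) x = (Δ F) x + (Δ G) x := fun x =>
    hF.contDiffAt.laplacian_add hG.contDiffAt
  simp only [e] at h
  rw [← h, ← integral_sub (integrableOn_gradSq hF1) (integrableOn_gradSq hG1)]
  refine integral_congr_ae (Eventually.of_forall fun x => ?_)
  simp only [gradSq_eq, ← Finset.sum_sub_distrib]
  refine Finset.sum_congr rfl fun i _ => ?_
  rw [pd_sub dF dG, pd_add dF dG, inner_sub_left, inner_add_right, inner_add_right,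
    real_inner_self_eq_norm_sq, real_inner_self_eq_norm_sq, real_inner_comm (pd i F x) (pd i G x)]
  ring

namespace IsSolution

variable {ε : ℝ} {u₀ : Torus → Plane} {u : ℝ → Torus → Plane}

theorem continuousOn_laplacian (hu : IsSolution ε u₀ u) :
    ContinuousOn (fun p : ℝ × Plane => (Δ (lift (u p.1))) p.2) (Set.Ioi 0 ×ˢ Set.univ) := by
  have h : ContinuousOn (fun p : ℝ × Plane => ∑ i : Fin 2,
      fderiv ℝ (fderiv ℝ (lift (u p.1))) p.2 (EuclideanSpace.single i 1)
        (EuclideanSpace.single i 1)) (Set.Ioi 0 ×ˢ Set.univ) :=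
    continuousOn_finsetSum _ fun i _ =>
      (hu.continuousOn_fderiv_fderiv.clm_apply continuousOn_const).clm_apply continuousOn_const
  refine h.congr fun p hp => ?_
  rw [laplacian_eq_sum_pd (hu.contDiff_space p.1 hp.1)]
  exact Finset.sum_congr rfl fun i _ => pd_pd_eq (hu.contDiff_space p.1 hp.1) i p.2

/-- The velocity `∂ₜu = ε² Δu + (1 - |u|²) u`. -/
def velocity (ε : ℝ) (F : Plane → Plane) (x : Plane) : Plane :=
  ε ^ 2 • (Δ F) x + (1 - ‖F x‖ ^ 2) • F x

theorem hasDerivAt_potential (hu : IsSolution ε u₀ u) {t : ℝ} (ht : 0 < t) (x : Plane) :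
    HasDerivAt (fun s => (1 - ‖lift (u s) x‖ ^ 2) ^ 2)
      (-4 * (1 - ‖lift (u t) x‖ ^ 2) * inner ℝ (lift (u t) x) (velocity ε (lift (u t)) x)) t := by
  refine (((hu.hasDerivAt_time ht x).norm_sq.const_sub 1).pow 2).congr_deriv ?_
  simp only [velocity]
  push_cast
  ring

/-- Supplies the dominating constant for differentiation under the integral; the time window stays
away from `t = 0`, where derivatives are not controlled. -/
theorem exists_local_bounds (hu : IsSolution ε u₀ u) {t₀ : ℝ} (ht₀ : 0 < t₀) :
    ∃ C, 0 < C ∧ ∀ t ∈ Set.Icc (t₀ / 2) (2 * t₀), ∀ x ∈ closedCell,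
      ‖lift (u t) x‖ ≤ C ∧ ‖(Δ (lift (u t))) x‖ ≤ C ∧ ‖velocity ε (lift (u t)) x‖ ≤ C := by
  have hsub : Set.Icc (t₀ / 2) (2 * t₀) ×ˢ closedCell ⊆ Set.Ioi 0 ×ˢ Set.univ := fun p hp =>
    ⟨lt_of_lt_of_le (half_pos ht₀) hp.1.1, Set.mem_univ _⟩
  have hK : IsCompact (Set.Icc (t₀ / 2) (2 * t₀) ×ˢ closedCell) :=
    isCompact_Icc.prod isCompact_closedCell
  have h1 := hu.continuousOn_lift.mono (hsub.trans (Set.prod_mono Set.Ioi_subset_Ici_self le_rfl))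
  have h2 := hu.continuousOn_laplacian.mono hsub
  have h3 : ContinuousOn (fun p : ℝ × Plane => velocity ε (lift (u p.1)) p.2)
      (Set.Icc (t₀ / 2) (2 * t₀) ×ˢ closedCell) := by
    unfold velocity
    exact (h2.const_smul (ε ^ 2)).add ((continuousOn_const.sub (h1.norm.pow 2)).smul h1)
  obtain ⟨C1, hC1⟩ := hK.exists_bound_of_continuousOn h1
  obtain ⟨C2, hC2⟩ := hK.exists_bound_of_continuousOn h2
  obtain ⟨C3, hC3⟩ := hK.exists_bound_of_continuousOn h3
  refine ⟨|C1| + |C2| + |C3| + 1, by positivity, fun t ht x hx => ⟨?_, ?_, ?_⟩⟩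
  · have : ‖lift (u t) x‖ ≤ C1 := hC1 (t, x) ⟨ht, hx⟩
    linarith [le_abs_self C1, abs_nonneg C2, abs_nonneg C3]
  · have : ‖(Δ (lift (u t))) x‖ ≤ C2 := hC2 (t, x) ⟨ht, hx⟩
    linarith [le_abs_self C2, abs_nonneg C1, abs_nonneg C3]
  · have : ‖velocity ε (lift (u t)) x‖ ≤ C3 := hC3 (t, x) ⟨ht, hx⟩
    linarith [le_abs_self C3, abs_nonneg C2, abs_nonneg C1]

theorem freeEnergy_sub (hu : IsSolution ε u₀ u) {t₀ t : ℝ} (ht₀ : 0 < t₀) (ht : 0 < t) :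
    freeEnergy ε (lift (u t)) - freeEnergy ε (lift (u t₀))
      = ∫ x in unitCell, (-(1 / 2) * inner ℝ (lift (u t) x - lift (u t₀) x)
          ((Δ (lift (u t))) x + (Δ (lift (u t₀))) x)
        + 1 / (4 * ε ^ 2) * ((1 - ‖lift (u t) x‖ ^ 2) ^ 2 - (1 - ‖lift (u t₀) x‖ ^ 2) ^ 2)) := by
  have hF := hu.contDiff_space t ht
  have hG := hu.contDiff_space t₀ ht₀
  have hF1 : ContDiff ℝ 1 (lift (u t)) := hF.of_le (by norm_num)
  have hG1 : ContDiff ℝ 1 (lift (u t₀)) := hG.of_le (by norm_num)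
  have h := integral_gradSq_sub hF hG (isPeriodic_lift _) (isPeriodic_lift _)
  have i1 : IntegrableOn (fun x => -(1 / 2) * inner ℝ (lift (u t) x - lift (u t₀) x)
      ((Δ (lift (u t))) x + (Δ (lift (u t₀))) x)) unitCell :=
    integrableOn_unitCell (continuous_const.mul ((hF.continuous.sub hG.continuous).inner
      ((continuous_laplacian hF).add (continuous_laplacian hG))))
  have p1 := integrableOn_potential hF.continuous (1 / (4 * ε ^ 2))
  have p2 := integrableOn_potential hG.continuous (1 / (4 * ε ^ 2))
  have p3 : IntegrableOn (fun x => 1 / (4 * ε ^ 2) * (1 - ‖lift (u t) x‖ ^ 2) ^ 2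
      - 1 / (4 * ε ^ 2) * (1 - ‖lift (u t₀) x‖ ^ 2) ^ 2) unitCell := p1.sub p2
  simp only [mul_sub]
  rw [integral_add i1 p3, integral_sub p1 p2]
  unfold freeEnergy
  rw [integral_add ((integrableOn_gradSq hF1).div_const 2) p1,
    integral_add ((integrableOn_gradSq hG1).div_const 2) p2, integral_div, integral_div,
    integral_const_mul (-(1 / 2) : ℝ)]
  linarith

theorem norm_sub_le_of_local_bound {V : Type*} [NormedAddCommGroup V] [NormedSpace ℝ V]
    {f : ℝ → V} {f' : ℝ → V} {t₀ C : ℝ} (ht₀ : 0 < t₀)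
    (hf : ∀ t ∈ Set.Icc (t₀ / 2) (2 * t₀), HasDerivAt f (f' t) t)
    (hC : ∀ t ∈ Set.Icc (t₀ / 2) (2 * t₀), ‖f' t‖ ≤ C) {t : ℝ}
    (ht : t ∈ Set.Icc (t₀ / 2) (2 * t₀)) : ‖(t - t₀)⁻¹ • (f t - f t₀)‖ ≤ C := by
  have ht₀' : t₀ ∈ Set.Icc (t₀ / 2) (2 * t₀) := ⟨by linarith, by linarith⟩
  have hC0 : 0 ≤ C := (norm_nonneg _).trans (hC t₀ ht₀')
  have h := (convex_Icc (t₀ / 2) (2 * t₀)).norm_image_sub_le_of_norm_hasDerivWithin_le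
    (fun s hs => (hf s hs).hasDerivWithinAt) hC ht₀' ht
  rw [norm_smul, norm_inv]
  rcases eq_or_ne t t₀ with rfl | hne
  · simpa using hC0
  · rw [inv_mul_le_iff₀ (norm_pos_iff.2 (sub_ne_zero.2 hne)), mul_comm]
    exact h

/-- Difference quotients of `freeEnergy_sub` contain only time quotients of `u` and of the
potential, together with `Δu`, so dominated convergence applies. -/
theorem hasDerivAt_freeEnergy (hε : 0 < ε) (hu : IsSolution ε u₀ u) {t₀ : ℝ} (ht₀ : 0 < t₀) :
    HasDerivAt (fun t => freeEnergy ε (lift (u t)))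
      (-(1 / ε ^ 2) * ∫ x in unitCell, ‖velocity ε (lift (u t₀)) x‖ ^ 2) t₀ := by
  obtain ⟨C, hC0, hC⟩ := hu.exists_local_bounds ht₀
  have hIcc : Set.Icc (t₀ / 2) (2 * t₀) ∈ 𝓝 t₀ := Icc_mem_nhds (by linarith) (by linarith)
  have hpos : ∀ t ∈ Set.Icc (t₀ / 2) (2 * t₀), 0 < t := fun t ht => by linarith [ht.1]
  rw [hasDerivAt_iff_tendsto_slope]
  set G : ℝ → Plane → ℝ := fun t x =>
    -(1 / 2) * inner ℝ ((t - t₀)⁻¹ • (lift (u t) x - lift (u t₀) x))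
      ((Δ (lift (u t))) x + (Δ (lift (u t₀))) x)
    + 1 / (4 * ε ^ 2) * ((t - t₀)⁻¹ • ((1 - ‖lift (u t) x‖ ^ 2) ^ 2
        - (1 - ‖lift (u t₀) x‖ ^ 2) ^ 2)) with hG
  have hslope : ∀ t ∈ Set.Icc (t₀ / 2) (2 * t₀),
      slope (fun t => freeEnergy ε (lift (u t))) t₀ t = ∫ x in unitCell, G t x := by
    intro t ht
    rw [slope_def_module, hu.freeEnergy_sub ht₀ (hpos t ht), smul_eq_mul, ← integral_const_mul]
    refine integral_congr_ae (Eventually.of_forall fun x => ?_)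
    simp only [hG, real_inner_smul_left, smul_eq_mul]
    ring
  have hlim : ∫ x in unitCell, (-(1 / ε ^ 2)) * ‖velocity ε (lift (u t₀)) x‖ ^ 2
      = -(1 / ε ^ 2) * ∫ x in unitCell, ‖velocity ε (lift (u t₀)) x‖ ^ 2 :=
    integral_const_mul _ _
  rw [← hlim]
  refine Tendsto.congr' (f₁ := fun t => ∫ x in unitCell, G t x) ?_ ?_
  · filter_upwards [mem_nhdsWithin_of_mem_nhds hIcc] with t ht using (hslope t ht).symm
  refine tendsto_integral_filter_of_dominated_convergence
    (fun _ => 1 / 2 * (C * (C + C)) + 1 / (4 * ε ^ 2) * (4 * (1 + C ^ 2) * (C * C))) ?_ ?_ ?_ ?_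
  · filter_upwards [mem_nhdsWithin_of_mem_nhds hIcc] with t ht
    have hF := hu.contDiff_space t (hpos t ht)
    have hF0 := hu.contDiff_space t₀ ht₀
    have c1 := hF.continuous
    have c2 := hF0.continuous
    have c3 := continuous_laplacian hF
    have c4 := continuous_laplacian hF0
    refine Continuous.aestronglyMeasurable ?_
    simp only [hG]
    fun_prop
  · filter_upwards [mem_nhdsWithin_of_mem_nhds hIcc] with t ht
    filter_upwards [ae_restrict_mem measurableSet_unitCell] with x hx
    have hx' := unitCell_subset_closedCell hx
    have ht₀' : t₀ ∈ Set.Icc (t₀ / 2) (2 * t₀) := ⟨by linarith, by linarith⟩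
    have b1 := norm_sub_le_of_local_bound ht₀ (f := fun s => lift (u s) x)
      (fun s hs => hu.hasDerivAt_time (hpos s hs) x) (fun s hs => (hC s hs x hx').2.2) ht
    have b2 := norm_sub_le_of_local_bound ht₀ (f := fun s => (1 - ‖lift (u s) x‖ ^ 2) ^ 2)
      (C := 4 * (1 + C ^ 2) * (C * C))
      (fun s hs => hu.hasDerivAt_potential (hpos s hs) x) (fun s hs => by
        obtain ⟨h1, -, h3⟩ := hC s hs x hx'
        have h4 : ‖(1 : ℝ) - ‖lift (u s) x‖ ^ 2‖ ≤ 1 + C ^ 2 := by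
          refine (norm_sub_le _ _).trans ?_
          rw [norm_one, norm_pow, norm_norm]
          gcongr
        have h5 : ‖inner ℝ (lift (u s) x) (velocity ε (lift (u s)) x)‖ ≤ C * C :=
          (norm_inner_le_norm _ _).trans (mul_le_mul h1 h3 (norm_nonneg _) hC0.le)
        rw [norm_mul, norm_mul]
        have h6 : ‖(-4 : ℝ)‖ = 4 := by norm_num
        rw [h6]
        gcongr) ht
    simp only [hG]
    refine (norm_add_le _ _).trans (add_le_add ?_ ?_)
    · rw [norm_mul]
      have h6 : ‖(-(1 / 2) : ℝ)‖ = 1 / 2 := by norm_num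
      rw [h6]
      refine mul_le_mul_of_nonneg_left ?_ (by norm_num)
      refine (norm_inner_le_norm _ _).trans ?_
      refine mul_le_mul b1 ((norm_add_le _ _).trans (add_le_add (hC t ht x hx').2.1
        (hC t₀ ht₀' x hx').2.1)) (norm_nonneg _) hC0.le
    · rw [norm_mul, Real.norm_of_nonneg (by positivity : 0 ≤ 1 / (4 * ε ^ 2))]
      exact mul_le_mul_of_nonneg_left b2 (by positivity)
  · exact integrable_const _
  · refine Eventually.of_forall fun x => ?_
    have l1 := (hu.hasDerivAt_time ht₀ x).tendsto_slope
    have l2 := (hu.hasDerivAt_potential ht₀ x).tendsto_slope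
    have l3 : Tendsto (fun t => (Δ (lift (u t))) x) (𝓝[≠] t₀) (𝓝 ((Δ (lift (u t₀))) x)) := by
      have hc : ContinuousAt (fun p : ℝ × Plane => (Δ (lift (u p.1))) p.2) (t₀, x) :=
        hu.continuousOn_laplacian.continuousAt
          (prod_mem_nhds (Ioi_mem_nhds ht₀) univ_mem)
      have hc2 : ContinuousAt (fun t : ℝ => (t, x)) t₀ := by fun_prop
      exact (ContinuousAt.comp (f := fun t : ℝ => (t, x)) hc hc2).tendsto.mono_left
        nhdsWithin_le_nhds
    have l4 := ((l1.inner (l3.add_const ((Δ (lift (u t₀))) x))).const_mul (-(1 / 2))).add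
      (l2.const_mul (1 / (4 * ε ^ 2)))
    simp only [slope_def_module] at l4
    -- The limit integrand is `-∂ₜu·(Δu + ε⁻²(1 - |u|²)u)`, and the bracket is `ε⁻²∂ₜu`.
    have e : -(1 / ε ^ 2) * ‖velocity ε (lift (u t₀)) x‖ ^ 2
        = -(1 / 2) * inner ℝ (velocity ε (lift (u t₀)) x)
            ((Δ (lift (u t₀))) x + (Δ (lift (u t₀))) x)
          + 1 / (4 * ε ^ 2) * (-4 * (1 - ‖lift (u t₀) x‖ ^ 2)
            * inner ℝ (lift (u t₀) x) (velocity ε (lift (u t₀)) x)) := by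
      rw [← real_inner_self_eq_norm_sq]
      nth_rw 2 [velocity]
      rw [inner_add_right, inner_add_right, real_inner_smul_right, real_inner_smul_right,
        real_inner_comm (velocity ε (lift (u t₀)) x) (lift (u t₀) x)]
      field_simp
      ring
    rw [e]
    exact l4

theorem antitoneOn_freeEnergy (hε : 0 < ε) (hu : IsSolution ε u₀ u) :
    AntitoneOn (fun t => freeEnergy ε (lift (u t))) (Set.Ioi 0) := by
  refine antitoneOn_of_deriv_nonpos (convex_Ioi 0) ?_ ?_ ?_
  · exact fun t ht => (hu.hasDerivAt_freeEnergy hε ht).continuousAt.continuousWithinAt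
  · rw [interior_Ioi]
    exact fun t ht => (hu.hasDerivAt_freeEnergy hε ht).differentiableAt.differentiableWithinAt
  · rw [interior_Ioi]
    intro t ht
    rw [(hu.hasDerivAt_freeEnergy hε ht).deriv, neg_mul]
    have : 0 ≤ ∫ x in unitCell, ‖velocity ε (lift (u t)) x‖ ^ 2 :=
      integral_nonneg fun x => by positivity
    have h2 : 0 ≤ 1 / ε ^ 2 := by positivity
    exact neg_nonpos.2 (mul_nonneg h2 this)

end IsSolution

end

/-! ### The energy at the entry time. -/

section

open MeasureTheory Real

namespace IsSolution

variable {ε : ℝ} {u₀ : Torus → Plane} {u : ℝ → Torus → Plane}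

/-- Pointwise decay of `e^{2t} - (e^{2t} - 1) |u|²` away from the zeros of `d`. -/
theorem defect_mul_le (hu : IsSolution ε u₀ u) {K M : ℝ} (hK : 0 < K) (hM : 0 ≤ M)
    (hLip : ∀ x y, ‖lift u₀ y - lift u₀ x‖ ^ 2 ≤ K * ‖y - x‖ ^ 2)
    {d : Plane → ℝ} (hd : ContDiff ℝ 2 d) (hdper : IsPeriodic d) (hd0 : ∀ x, 0 ≤ d x)
    (hdle : ∀ x, d x ≤ ‖lift u₀ x‖ ^ 2) (hgrad : ∀ i x, (pd i d x) ^ 2 ≤ M * d x)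
    (hlap : ∀ x, |(Δ d) x| ≤ M) {t : ℝ} (ht : 0 < t) (h1 : ε ^ 2 * exp (2 * t) ≤ 1)
    (h2 : ε ^ 2 * exp (2 * t) * t ≤ 1) (x : Plane) :
    (exp (2 * t) - (exp (2 * t) - 1) * ‖lift (u t) x‖ ^ 2)
      * (1 + (exp (2 * t) - 1) * exp (-((8 * K + 4 * M) / 2)) * d x)
      ≤ (1 + (8 * K + 4 * M)) * exp (2 * t) := by
  have hb := hu.barrier_le hK hM hLip hd hdper hd0 hdle hgrad hlap ht.le x
  have hN0 : 0 ≤ exp (2 * t) - (exp (2 * t) - 1) * ‖lift (u t) x‖ ^ 2 :=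
    nonneg_of_mul_nonneg_right ((sq_nonneg _).trans (hu.norm_pd_sq_le hK.le hLip ht x 0)) hK
  have hE1 : 1 ≤ exp (2 * t) := one_le_exp (by linarith)
  set B := 8 * K + 4 * M
  have hB0 : 0 ≤ B := by positivity
  have hε : 0 ≤ ε ^ 2 := sq_nonneg _
  -- `ε²E ≤ 1` keeps the exponential loss in the barrier bounded.
  have hA : exp (-(B / 2)) ≤ exp (-(B * ε ^ 2 * (exp (2 * t) - 1) / 2)) := by
    refine exp_le_exp.2 ?_
    nlinarith [mul_nonneg hB0 hε]
  set E := exp (2 * t)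
  set m := ‖lift (u t) x‖ ^ 2
  have hm : 0 ≤ m := by positivity
  set N := E - (E - 1) * m with hN
  have hs : 0 ≤ E - 1 := by linarith
  have hNE : N ≤ E := by nlinarith [mul_nonneg hs hm]
  have e1 : exp (-(B / 2)) * d x ≤ exp (-(B * ε ^ 2 * (E - 1) / 2)) * d x :=
    mul_le_mul_of_nonneg_right hA (hd0 x)
  have e2 : (E - 1) * (exp (-(B / 2)) * d x * N)
      ≤ (E - 1) * (exp (-(B * ε ^ 2 * (E - 1) / 2)) * d x * N) :=
    mul_le_mul_of_nonneg_left (mul_le_mul_of_nonneg_right e1 hN0) hs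
  -- The barrier `qN ≤ m` times `E - 1`; adding `N` to both sides turns the right side into `E`. The
  -- linear loss moves to that side, where `ε²Et ≤ 1` bounds it by `BE`.
  have e3 : (E - 1) * (exp (-(B * ε ^ 2 * (E - 1) / 2)) * d x * N - B * ε ^ 2 * t * N)
      ≤ (E - 1) * m := mul_le_mul_of_nonneg_left (by linarith) hs
  have e4 : (E - 1) * (B * ε ^ 2 * t * N) ≤ B * E := by
    have f1 : (E - 1) * ε ^ 2 * t ≤ 1 := by nlinarith [mul_nonneg hε ht.le]
    calc _ = B * N * ((E - 1) * ε ^ 2 * t) := by ring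
      _ ≤ B * N * 1 := mul_le_mul_of_nonneg_left f1 (mul_nonneg hB0 hN0)
      _ ≤ B * E := by rw [mul_one]; exact mul_le_mul_of_nonneg_left hNE hB0
  linarith

/-- The gradient density is at most `2KN`, and the potential is a multiple of `(N - 1)² ≤ N² + 1`.
As the point `a` depends on `x`, the pointwise bound is replaced by the sum over all of `T` before
integrating. -/
theorem energy_le_of_defect_le (hu : IsSolution ε u₀ u) (hε : 0 < ε) {K : ℝ} (hK : 0 < K)
    (hLip : ∀ x y, ‖lift u₀ y - lift u₀ x‖ ^ 2 ≤ K * ‖y - x‖ ^ 2)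
    {T : Finset Plane} {D σ t : ℝ} (hD : 0 ≤ D) (hσ : 0 < σ) (ht : 0 < t)
    (hdef : ∀ x, ∃ a ∈ T, (exp (2 * t) - (exp (2 * t) - 1) * ‖lift (u t) x‖ ^ 2)
      * (1 + σ * chordSq a x) ≤ D) :
    energy ε (u t) ≤ 2 * K * (D * (T.card * (π / σ * log (1 + √σ))))
      + 1 / (4 * ε ^ 2 * (exp (2 * t) - 1) ^ 2) * (D ^ 2 * (T.card * (π ^ 2 / (4 * σ))) + 1) := by
  have hF := hu.contDiff_space t ht
  have hF1 : ContDiff ℝ 1 (lift (u t)) := hF.of_le (by norm_num)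
  have hg := hu.norm_pd_sq_le hK.le hLip ht
  have hs : 0 < exp (2 * t) - 1 := by
    have := one_lt_exp_iff.2 (by linarith : 0 < 2 * t); linarith
  set F := lift (u t) with hFdef
  set s := exp (2 * t) - 1 with hsdef
  set N : Plane → ℝ := fun x => exp (2 * t) - s * ‖F x‖ ^ 2 with hN
  have hN0 : ∀ x, 0 ≤ N x := fun x =>
    nonneg_of_mul_nonneg_right ((sq_nonneg _).trans (hg x 0)) hK
  have hNc : Continuous N := by have := hF.continuous; fun_prop
  have hpos : ∀ a x, 0 < 1 + σ * chordSq a x := fun a x => by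
    have := chordSq_nonneg a x; positivity
  have hRc : ∀ a, Continuous fun x => (1 + σ * chordSq a x)⁻¹ := fun a =>
    Continuous.inv₀ (continuous_const.add (continuous_const.mul (contDiff_chordSq a).continuous))
      fun x => (hpos a x).ne'
  have hle : ∀ x, ∃ a ∈ T, N x ≤ D * (1 + σ * chordSq a x)⁻¹ := fun x => by
    obtain ⟨a, ha, h⟩ := hdef x
    exact ⟨a, ha, (le_mul_inv_iff₀ (hpos a x)).2 h⟩
  have i1 : ∫ x in unitCell, N x ≤ D * (T.card * (π / σ * log (1 + √σ))) := by
    calc ∫ x in unitCell, N x ≤ ∫ x in unitCell, D * ∑ a ∈ T, (1 + σ * chordSq a x)⁻¹ := by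
          refine integral_mono (integrableOn_unitCell hNc) (integrableOn_unitCell
            (continuous_const.mul (continuous_finsetSum _ fun a _ => hRc a))) fun x => ?_
          obtain ⟨a, ha, h⟩ := hle x
          refine h.trans (mul_le_mul_of_nonneg_left ?_ hD)
          exact Finset.single_le_sum (f := fun a => (1 + σ * chordSq a x)⁻¹)
            (fun b _ => (inv_pos.2 (hpos b x)).le) ha
      _ = D * ∑ a ∈ T, ∫ x in unitCell, (1 + σ * chordSq a x)⁻¹ := by
          rw [integral_const_mul, integral_finsetSum _ fun a _ => integrableOn_unitCell (hRc a)]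
      _ ≤ D * ∑ _a ∈ T, (π / σ * log (1 + √σ)) := mul_le_mul_of_nonneg_left
          (Finset.sum_le_sum fun a _ => integral_inv_chordSq_le hσ a) hD
      _ = _ := by rw [Finset.sum_const, nsmul_eq_mul]
  have i2 : ∫ x in unitCell, N x ^ 2 ≤ D ^ 2 * (T.card * (π ^ 2 / (4 * σ))) := by
    calc ∫ x in unitCell, N x ^ 2
        ≤ ∫ x in unitCell, D ^ 2 * ∑ a ∈ T, ((1 + σ * chordSq a x)⁻¹) ^ 2 := by
          refine integral_mono (integrableOn_unitCell (hNc.pow 2)) (integrableOn_unitCell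
            (continuous_const.mul (continuous_finsetSum _ fun a _ => (hRc a).pow 2))) fun x => ?_
          obtain ⟨a, ha, h⟩ := hle x
          calc N x ^ 2 ≤ (D * (1 + σ * chordSq a x)⁻¹) ^ 2 := pow_le_pow_left₀ (hN0 x) h 2
            _ = D ^ 2 * ((1 + σ * chordSq a x)⁻¹) ^ 2 := mul_pow _ _ _
            _ ≤ _ := mul_le_mul_of_nonneg_left
              (Finset.single_le_sum (f := fun a => ((1 + σ * chordSq a x)⁻¹) ^ 2)
                (fun b _ => sq_nonneg _) ha) (sq_nonneg D)
      _ = D ^ 2 * ∑ a ∈ T, ∫ x in unitCell, ((1 + σ * chordSq a x)⁻¹) ^ 2 := by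
          have hi : ∀ a ∈ T, Integrable (fun x => ((1 + σ * chordSq a x)⁻¹) ^ 2)
            (volume.restrict unitCell) := fun a _ => integrableOn_unitCell ((hRc a).pow 2)
          rw [integral_const_mul, integral_finsetSum _ hi]
      _ ≤ D ^ 2 * ∑ _a ∈ T, (π ^ 2 / (4 * σ)) := mul_le_mul_of_nonneg_left
          (Finset.sum_le_sum fun a _ => integral_inv_chordSq_sq_le hσ a) (sq_nonneg D)
      _ = _ := by rw [Finset.sum_const, nsmul_eq_mul]
  have j1 : IntegrableOn (fun x => 2 * K * N x) unitCell :=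
    integrableOn_unitCell (continuous_const.mul hNc)
  have j0 : IntegrableOn (fun x => N x ^ 2) unitCell := integrableOn_unitCell (hNc.pow 2)
  have j2 : IntegrableOn (fun x => N x ^ 2 + 1) unitCell := j0.add (integrable_const 1)
  have j3 : IntegrableOn (fun x => 1 / (4 * ε ^ 2 * s ^ 2) * (N x ^ 2 + 1)) unitCell :=
    j2.const_mul _
  calc energy ε (u t)
      ≤ ∫ x in unitCell, (2 * K * N x + 1 / (4 * ε ^ 2 * s ^ 2) * (N x ^ 2 + 1)) := by
        refine integral_mono ((integrableOn_gradSq hF1).add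
          (integrableOn_potential hF.continuous _)) (j1.add j3) fun x => ?_
        refine add_le_add ?_ ?_
        · rw [← hFdef, gradSq_eq, Fin.sum_univ_two]
          linarith [hg x 0, hg x 1]
        · have e : 1 / (4 * ε ^ 2) * (1 - ‖F x‖ ^ 2) ^ 2
              = 1 / (4 * ε ^ 2 * s ^ 2) * (N x - 1) ^ 2 := by
            have : N x - 1 = s * (1 - ‖F x‖ ^ 2) := by simp only [hN, hsdef]; ring
            rw [this]
            field_simp
          rw [← hFdef, e]
          refine mul_le_mul_of_nonneg_left ?_ (by positivity)
          linarith [hN0 x, sq_nonneg (N x), (by ring : (N x - 1) ^ 2 = N x ^ 2 - 2 * N x + 1)]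
    _ = 2 * K * (∫ x in unitCell, N x)
        + 1 / (4 * ε ^ 2 * s ^ 2) * ((∫ x in unitCell, N x ^ 2) + 1) := by
        rw [integral_add j1 j3, integral_const_mul, integral_const_mul,
          integral_add j0 (integrable_const _)]
        simp
    _ ≤ _ := by gcongr

end IsSolution

/-- The energy bound at a time `t` with `ε² e^{2t} ≲ 1 / t`. -/
theorem exists_energy_bound {u₀ : Torus → Plane} (hu₀ : ContDiff ℝ 1 (lift u₀))
    (hdet : ∀ x, lift u₀ x = 0 → (fderiv ℝ (lift u₀) x).det ≠ 0) :
    ∃ P Q : ℝ, 0 < P ∧ 0 < Q ∧ ∀ ε : ℝ, 0 < ε → ∀ u : ℝ → Torus → Plane, IsSolution ε u₀ u →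
      ∀ t : ℝ, 1 / 2 ≤ t → ε ^ 2 * exp (2 * t) ≤ 1 → ε ^ 2 * exp (2 * t) * t ≤ 1 →
        energy ε (u t) ≤ P * (t + 1) + Q * (ε ^ 2 * exp (2 * t))⁻¹ := by
  obtain ⟨K, hK, hLip⟩ := exists_lipschitz_sq hu₀ (isPeriodic_lift u₀)
  obtain ⟨d, T, M, c, hM, hc, hT, hd, hdper, hd0, hdle, hgrad, hlap, hmin⟩ :=
    exists_smooth_minorant hu₀ (isPeriodic_lift u₀) hdet
  set B := 8 * K + 4 * M with hB
  have hB0 : 0 < B := by positivity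
  -- Capping `c` at 1 ensures `c' ≤ 1`, hence `√σ ≤ e^t` in the logarithm.
  set c' := exp (-(B / 2)) * min c 1 with hc'
  have hcm : 0 < min c 1 := lt_min hc one_pos
  have hc'0 : 0 < c' := mul_pos (exp_pos _) hcm
  have hc'1 : c' ≤ 1 := mul_le_one₀ (exp_le_one_iff.2 (by linarith)) hcm.le (min_le_right _ _)
  have hn : (0 : ℝ) < T.card := by exact_mod_cast hT.card_pos
  have hπ := pi_pos
  refine ⟨4 * π * K * (1 + B) * T.card / c', (1 + B) ^ 2 * T.card * π ^ 2 / (2 * c') + 1,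
    by positivity, by positivity, fun ε hε u hu t ht h1 h2 => ?_⟩
  have ht0 : 0 < t := by linarith
  have hE2 : 2 ≤ exp (2 * t) := by linarith [add_one_le_exp (2 * t)]
  have hs : 0 < exp (2 * t) - 1 := by linarith
  have hσ : 0 < (exp (2 * t) - 1) * c' := mul_pos hs hc'0
  have hmain := hu.energy_le_of_defect_le hε hK hLip (T := T) (D := (1 + B) * exp (2 * t))
    (σ := (exp (2 * t) - 1) * c') (by positivity) hσ ht0 fun x => by
      obtain ⟨a, ha, hx⟩ := hmin x
      refine ⟨a, ha, le_trans ?_ (hu.defect_mul_le hK hM.le hLip hd hdper hd0 hdle hgrad hlap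
        ht0 h1 h2 x)⟩
      refine mul_le_mul_of_nonneg_left ?_ (nonneg_of_mul_nonneg_right
        ((sq_nonneg _).trans (hu.norm_pd_sq_le hK.le hLip ht0 x 0)) hK)
      have e : min c 1 * chordSq a x ≤ d x :=
        (mul_le_mul_of_nonneg_right (min_le_left _ _) (chordSq_nonneg a x)).trans hx
      have e2 := mul_le_mul_of_nonneg_left e (mul_nonneg hs.le (exp_pos (-(B / 2))).le)
      rw [hc']
      linarith
  refine hmain.trans (add_le_add ?_ ?_)
  · have hlog : log (1 + √((exp (2 * t) - 1) * c')) ≤ t + 1 := by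
      rw [log_le_iff_le_exp (by positivity)]
      have f1 : √((exp (2 * t) - 1) * c') ≤ exp t := by
        refine sqrt_le_iff.2 ⟨(exp_pos t).le, ?_⟩
        rw [← exp_nat_mul]
        push_cast
        nlinarith
      have f2 : 1 ≤ exp t := one_le_exp ht0.le
      rw [exp_add]
      nlinarith [add_one_le_exp (1 : ℝ)]
    have hratio : exp (2 * t) / ((exp (2 * t) - 1) * c') ≤ 2 / c' := by
      rw [div_le_div_iff₀ hσ hc'0]
      nlinarith
    calc _ = 2 * K * (1 + B) * T.card * π * ((exp (2 * t) / ((exp (2 * t) - 1) * c'))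
          * log (1 + √((exp (2 * t) - 1) * c'))) := by ring
      _ ≤ 2 * K * (1 + B) * T.card * π * ((2 / c') * (t + 1)) := by
          refine mul_le_mul_of_nonneg_left (mul_le_mul hratio hlog ?_ (by positivity))
            (by positivity)
          exact log_nonneg (by linarith [sqrt_nonneg ((exp (2 * t) - 1) * c')])
      _ = _ := by ring
  · set E := exp (2 * t) with hE
    have hEpos : 0 < E := exp_pos _
    have r1 : E / (E - 1) ≤ 2 := by rw [div_le_iff₀ hs]; linarith
    have r0 : 0 ≤ E / (E - 1) := by positivity
    have r2 : (E / (E - 1)) ^ 3 ≤ 8 := by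
      calc _ ≤ (2 : ℝ) ^ 3 := pow_le_pow_left₀ r0 r1 3
        _ = 8 := by norm_num
    have r3 : (E / (E - 1)) ^ 2 / E ≤ 4 := by
      rw [div_le_iff₀ hEpos]
      nlinarith [pow_le_pow_left₀ r0 r1 2]
    have q1 : 1 / (4 * ε ^ 2 * (E - 1) ^ 2) * (((1 + B) * E) ^ 2
          * (T.card * (π ^ 2 / (4 * ((E - 1) * c')))) + 1)
        = ((1 + B) ^ 2 * T.card * π ^ 2 / (16 * c') * (E / (E - 1)) ^ 3
          + 1 / 4 * ((E / (E - 1)) ^ 2 / E)) * (ε ^ 2 * E)⁻¹ := by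
      have := hs.ne'
      field_simp
      ring
    rw [q1]
    refine mul_le_mul_of_nonneg_right (add_le_add ?_ (by linarith)) (by positivity)
    calc _ ≤ (1 + B) ^ 2 * T.card * π ^ 2 / (16 * c') * 8 :=
          mul_le_mul_of_nonneg_left r2 (by positivity)
      _ = _ := by field_simp; ring

/-- At the entry time, `ε² e^{2t} = e^{-2C₀} / ln (1/ε)`. -/
theorem sq_mul_exp_entryTime (C₀ : ℝ) {ε : ℝ} (hε : 0 < ε) (hL : 0 < log (1 / ε)) :
    ε ^ 2 * exp (2 * entryTime C₀ ε) = exp (-(2 * C₀)) * (log (1 / ε))⁻¹ := by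
  have e : 2 * entryTime C₀ ε
      = -(log ε + log ε) + -log (log (1 / ε)) + -(2 * C₀) := by
    unfold entryTime
    rw [show log (1 / ε) = -log ε by rw [one_div, log_inv]]
    ring
  rw [e, exp_add, exp_add, exp_neg (log ε + log ε), exp_add, exp_log hε,
    exp_neg (log (log (1 / ε))), exp_log hL]
  field_simp

end

end GinzburgLandau

end

/-! ### Conclusion: entry time and dissipation. -/

theorem theorem2
    (u₀ : GinzburgLandau.Torus → GinzburgLandau.Plane)
    (hu₀ : ContDiff ℝ 1 (GinzburgLandau.lift u₀))
    (α₀ : ℝ) (hα₀ : 0 < α₀)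
    (hnondeg : ∀ x : GinzburgLandau.Plane,
      α₀ ≤ ‖GinzburgLandau.lift u₀ x‖ + |(fderiv ℝ (GinzburgLandau.lift u₀) x).det|)
    (C₀ : ℝ) (hC₀ : 0 < C₀) :
    ∃ C : ℝ, 0 < C ∧ ∃ ε₀ : ℝ, 0 < ε₀ ∧
      ∀ ε : ℝ, 0 < ε → ε < ε₀ →
      ∀ u : ℝ → GinzburgLandau.Torus → GinzburgLandau.Plane,
        GinzburgLandau.IsSolution ε u₀ u →
        ∀ t : ℝ, GinzburgLandau.entryTime C₀ ε ≤ t →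
          GinzburgLandau.energy ε (u t) ≤ C * Real.log (1 / ε) := by
  have hdet : ∀ x, GinzburgLandau.lift u₀ x = 0 →
      (fderiv ℝ (GinzburgLandau.lift u₀) x).det ≠ 0 := fun x hx h => by
    have := hnondeg x
    rw [hx, h] at this
    simp at this
    linarith
  obtain ⟨P, Q, hP, hQ, hbound⟩ := GinzburgLandau.exists_energy_bound hu₀ hdet
  -- The outer 2 is the cost of passing through the free energy, and the inner one comes from `τ + 1
  -- ≤ 2L`. The threshold for `ε` means `L > 1 + 2C₀`; with `log L ≤ L - 1` this keeps the entry
  -- time above `1/2`.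
  refine ⟨2 * (2 * P + Q * Real.exp (2 * C₀)), by positivity, Real.exp (-(1 + 2 * C₀)),
    Real.exp_pos _, fun ε hε hε₀ u hu t ht => ?_⟩
  set L := Real.log (1 / ε) with hL
  have hL1 : 1 + 2 * C₀ < L := by
    rw [hL, one_div, Real.log_inv]
    have := Real.log_lt_log hε hε₀
    rw [Real.log_exp] at this
    linarith
  have hL0 : 0 < L := by linarith
  have hsq := GinzburgLandau.sq_mul_exp_entryTime C₀ hε hL0
  rw [← hL] at hsq
  set τ := GinzburgLandau.entryTime C₀ ε with hτ
  have hτdef : τ = L - 1 / 2 * Real.log L - C₀ := rfl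
  have hτ1 : 1 / 2 ≤ τ := by
    linarith [Real.log_le_sub_one_of_pos hL0]
  have hlogL : 0 ≤ Real.log L := Real.log_nonneg (by linarith)
  have hτL : τ ≤ L := by linarith
  have hτ0 : 0 < τ := by linarith
  have hexp : Real.exp (-(2 * C₀)) ≤ 1 := Real.exp_le_one_iff.2 (by linarith)
  have hinv : L⁻¹ ≤ 1 := inv_le_one_of_one_le₀ (by linarith)
  have hinv0 : 0 < L⁻¹ := inv_pos.2 hL0
  have h1 : ε ^ 2 * Real.exp (2 * τ) ≤ 1 := by
    rw [hsq]; exact mul_le_one₀ hexp hinv0.le hinv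
  have h2 : ε ^ 2 * Real.exp (2 * τ) * τ ≤ 1 := by
    rw [hsq, mul_assoc]
    refine mul_le_one₀ hexp (by positivity) ?_
    rw [inv_mul_le_iff₀ hL0]
    linarith
  have hE := hbound ε hε u hu τ hτ1 h1 h2
  rw [hsq, mul_inv, inv_inv, ← Real.exp_neg, neg_neg] at hE
  have hcd : ∀ r, 0 < r → ContDiff ℝ 1 (GinzburgLandau.lift (u r)) := fun r hr =>
    (hu.contDiff_space r hr).of_le (by norm_num)
  calc GinzburgLandau.energy ε (u t)
      ≤ 2 * GinzburgLandau.freeEnergy ε (GinzburgLandau.lift (u t)) :=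
        GinzburgLandau.energy_le_two_mul_freeEnergy ε (hcd t (hτ0.trans_le ht))
    _ ≤ 2 * GinzburgLandau.freeEnergy ε (GinzburgLandau.lift (u τ)) := by
        have := hu.antitoneOn_freeEnergy hε hτ0 (hτ0.trans_le ht) ht
        simp only at this
        linarith
    _ ≤ 2 * GinzburgLandau.energy ε (u τ) := by
        linarith [GinzburgLandau.freeEnergy_le_energy ε (hcd τ hτ0)]
    _ ≤ 2 * (2 * P + Q * Real.exp (2 * C₀)) * L := by nlinarith
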